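/- For integers $n,k\ge 0$ put $h_n=\sum_{m=1}^{n}\frac1{2m-1}$ and $$t_k(2)=\sum_{m_2=0}^{k}\frac1{m_2+1}\sum_{m_1=0}^{m_2}\frac1{m_1+\frac12}.$$ Let $\psi^{(0)}=\psi=\Gamma'/\Gamma$ be the digamma function, $\psi^{(1)}=\psi'$, and for real $x>-1$ let $H_x=\psi(x+1)+\gamma$, with $\gamma$ the Euler–Mascheroni constant. Let $\beta(s)=\sum_{n\ge0}\frac{(-1)^n}{(2n+1)^s}$, $G=\beta(2)$, and $W(3)=\operatorname{Im}\operatorname{Li}_3\!\left(\frac{1+i}{2}\right)$, where $\operatorname{Li}_3(z)=\sum_{n\ge1}z^n/n^3$. For integers $k\ge0$ and $1\le j\le k+1$ put $$A_{k,j}=\frac{\pi^2}{8}-\sum_{j'=1}^{k+1-j}(-1)^{j'+1}\,\frac{\pi+H_{\frac{2k-2j-2j'+1}{4}}-H_{\frac{2k-2j-2j'+3}{4}}}{2(k-j-j'+2)}-(-1)^{k+1-j}\,2G+\frac{(-1)^{k+1-j}\,\pi\ln 2}{2}$$ and $$\begin{aligned} B_{k,j}={}&-\frac{\pi^2}{16}+\frac{k+1-j}{2k+3-2j}\,A_{k,j}\\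 &-2\Bigg[\sum_{j'=1}^{k+1-j}\frac{(-1)^{j'+1}}{64(k+2-j-j')^2}\Big(-4\pi+4\psi^{(0)}\big(\tfrac{2k+7-2j-2j'}{4}\big)-4\psi^{(0)}\big(\tfrac{2k+5-2j-2j'}{4}\big)\\ &\qquad-2(k+2-j-j')\,\psi^{(1)}\big(\tfrac{2k+7-2j-2j'}{4}\big)+2(k+2-j-j')\,\psi^{(1)}\big(\tfrac{2k+5-2j-2j'}{4}\big)\Big)\\ &\qquad+\frac{(-1)^{k+1-j}}{96}\big(3\pi^3+6\pi(\ln2)^2-192\,W(3)\big)\Bigg]\\ &+2\Bigg[\sum_{j'=1}^{k+1-j}(-1)^{j'+1}\,\frac{\pi+H_{\frac{2k+1-2j-2j'}{4}}-H_{\frac{2k+3-2j-2j'}{4}}}{8(k+2-j-j')}+(-1)^{k+1-j}\Big(\frac G2-\frac{\pi\ln2}{8}\Big)\Bigg]. \end{aligned}$$ Then for every integer $k\ge0$ the following two series over $j$ and over $n$ converge absolutely, and $$\begin{aligned} \sum_{j=1}^{\infty}\sum_{i=1}^{j}\frac{(-1)^j\,3h_i}{i(2j+1)(2j+2k+3)^2}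 ={}&\frac34\sum_{n=0}^{\infty}\frac{(-1)^{n+1}\,t_n(2)}{(n+\frac32)(2n+2k+5)^2}\\ ={}&-\frac{\pi^3}{128(k+1)}+\frac{(2k+1)\pi^3}{256(k+1)^2}-\frac{3(2k+1)}{4(k+1)^2}\sum_{j=1}^{k+1}\frac{(-1)^{j+1}}{2(2k+3-2j)}A_{k,j}\\ &-\frac{(-1)^{k+1}(2k+1)\pi^3}{256(k+1)^2}-\frac{3}{2(k+1)}\sum_{j=1}^{k+1}\frac{(-1)^{j+1}}{2k+3-2j}B_{k,j}\\ &-\frac{(-1)^{k+1}\big(-3G\pi^2+24\beta(4)\big)}{32(k+1)}+\frac{3}{2(k+1)}\sum_{j=1}^{k+1}\frac{(-1)^{j+1}}{2(2k+3-2j)}A_{k,j}+\frac{(-1)^{k+1}\pi^3}{128(k+1)}. \end{aligned}$$ -/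

import Mathlib

namespace ArctanSums

open Finset

noncomputable section

/-- The odd harmonic number `h_n = 1 + 1/3 + ... + 1/(2n-1)`. -/
def oddHarmonic (n : ℕ) : ℝ := ∑ m ∈ Icc 1 n, 1 / (2 * (m : ℝ) - 1)

/-- The Milgram constant `t_k(n)`, with first argument `n` (the number of nested sums) and second
argument `k` (the upper limit of the outermost sum):
`t_k(n) = ∑_{m=0}^{k} t_m(n-1) / (m + n/2)`, and `t_k(0) = 1` (no sum). -/
def milgram : ℕ → ℕ → ℝ
  | 0, _ => 1
  | n + 1, k => ∑ m ∈ range (k + 1), 1 / ((m : ℝ) + ((n : ℝ) + 1) / 2) * milgram n m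

/-- The polygamma function `ψ^{(n)}(x)`: the `n`-th derivative of `ψ = Γ' / Γ`. -/
def polygamma (n : ℕ) (x : ℝ) : ℝ := iteratedDeriv n (logDeriv Real.Gamma) x

/-- The harmonic number of real index `x > -1`, `H_x = ψ(x + 1) + γ`. -/
def genHarmonic (x : ℝ) : ℝ := polygamma 0 (x + 1) + Real.eulerMascheroniConstant

/-- The Dirichlet beta function at the positive integer `s`. -/
def dirichletBeta (s : ℕ) : ℝ := ∑' n : ℕ, (-1 : ℝ) ^ n / (2 * (n : ℝ) + 1) ^ s

/-- The Catalan constant. -/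
def catalan : ℝ := dirichletBeta 2

/-- The polylogarithm `Li_s(z)` for `‖z‖ ≤ 1` and an integer `s ≥ 2`. -/
def polylog (s : ℕ) (z : ℂ) : ℂ := ∑' n : ℕ, z ^ (n + 1) / ((n : ℂ) + 1) ^ s

/-- `W(3) = Im Li_3((1 + i) / 2)`. -/
def W3 : ℝ := (polylog 3 ((1 + Complex.I) / 2)).im

/-- `A_{k,j} = π²/8 - ∑_{j'=1}^{k+1-j} (-1)^{j'+1}
  (π + H_{(2k-2j-2j'+1)/4} - H_{(2k-2j-2j'+3)/4}) / (2(k-j-j'+2))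
  - (-1)^{k+1-j} 2G + (-1)^{k+1-j} π ln 2 / 2`, for `1 ≤ j ≤ k + 1`. -/
def blockA (k j : ℕ) : ℝ :=
  Real.pi ^ 2 / 8
    - ∑ i ∈ Icc 1 (k + 1 - j), (-1 : ℝ) ^ (i + 1) *
        ((Real.pi + genHarmonic ((2 * (k : ℝ) - 2 * j - 2 * i + 1) / 4)
            - genHarmonic ((2 * (k : ℝ) - 2 * j - 2 * i + 3) / 4))
          / (2 * ((k : ℝ) - j - i + 2)))
    - (-1 : ℝ) ^ (k + 1 - j) * 2 * catalan
    + (-1 : ℝ) ^ (k + 1 - j) * Real.pi * Real.log 2 / 2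

/-- `B_{k,j}`: the expression in the outer braces of the closed form, for `1 ≤ j ≤ k + 1`. -/
def blockB (k j : ℕ) : ℝ :=
  -Real.pi ^ 2 / 16
    + ((k : ℝ) + 1 - j) / (2 * (k : ℝ) + 3 - 2 * j) * blockA k j
    - 2 * (∑ i ∈ Icc 1 (k + 1 - j),
          (-1 : ℝ) ^ (i + 1) / (64 * ((k : ℝ) + 2 - j - i) ^ 2) *
            (-4 * Real.pi
              + 4 * polygamma 0 ((2 * (k : ℝ) + 7 - 2 * j - 2 * i) / 4)
              - 4 * polygamma 0 ((2 * (k : ℝ) + 5 - 2 * j - 2 * i) / 4)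
              - 2 * ((k : ℝ) + 2 - j - i) * polygamma 1 ((2 * (k : ℝ) + 7 - 2 * j - 2 * i) / 4)
              + 2 * ((k : ℝ) + 2 - j - i) * polygamma 1 ((2 * (k : ℝ) + 5 - 2 * j - 2 * i) / 4))
        + (-1 : ℝ) ^ (k + 1 - j) / 96 *
            (3 * Real.pi ^ 3 + 6 * Real.pi * Real.log 2 ^ 2 - 192 * W3))
    + 2 * (∑ i ∈ Icc 1 (k + 1 - j), (-1 : ℝ) ^ (i + 1) *
          ((Real.pi + genHarmonic ((2 * (k : ℝ) + 1 - 2 * j - 2 * i) / 4)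
              - genHarmonic ((2 * (k : ℝ) + 3 - 2 * j - 2 * i) / 4))
            / (8 * ((k : ℝ) + 2 - j - i)))
        + (-1 : ℝ) ^ (k + 1 - j) * (catalan / 2 - Real.pi * Real.log 2 / 8))

/-- The closed form. -/
def closedForm (k : ℕ) : ℝ :=
  -Real.pi ^ 3 / (128 * ((k : ℝ) + 1))
    + (2 * (k : ℝ) + 1) * Real.pi ^ 3 / (256 * ((k : ℝ) + 1) ^ 2)
    - 3 * (2 * (k : ℝ) + 1) / (4 * ((k : ℝ) + 1) ^ 2) *
        ∑ j ∈ Icc 1 (k + 1), (-1 : ℝ) ^ (j + 1) / (2 * (2 * (k : ℝ) + 3 - 2 * j)) * blockA k j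
    - (-1 : ℝ) ^ (k + 1) * (2 * (k : ℝ) + 1) * Real.pi ^ 3 / (256 * ((k : ℝ) + 1) ^ 2)
    - 3 / (2 * ((k : ℝ) + 1)) *
        ∑ j ∈ Icc 1 (k + 1), (-1 : ℝ) ^ (j + 1) / (2 * (k : ℝ) + 3 - 2 * j) * blockB k j
    - (-1 : ℝ) ^ (k + 1) * (-3 * catalan * Real.pi ^ 2 + 24 * dirichletBeta 4)
        / (32 * ((k : ℝ) + 1))
    + 3 / (2 * ((k : ℝ) + 1)) *
        ∑ j ∈ Icc 1 (k + 1), (-1 : ℝ) ^ (j + 1) / (2 * (2 * (k : ℝ) + 3 - 2 * j)) * blockA k j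
    + (-1 : ℝ) ^ (k + 1) * Real.pi ^ 3 / (128 * ((k : ℝ) + 1))

end

end ArctanSums

section

open Real intervalIntegral MeasureTheory Set Filter Topology

/-! Squaring the arctangent series and multiplying by the series of 1/(1+x²) gives arctan²x/(1+x²) =
Σ (-1)^n S_n x^(2n+2) on (0,1), where S_n = Σ_{i≤n+1} h_i/i (`hasSum_arctan_sq_div_one_add_sq`), and
t_n(2) = 2 S_n, so both series have the same terms. The weight w_N(x) = x^N log x/N + (1-x^N)/N² is
nonnegative and has moments ∫₀¹ x^n w_N = 1/((n+1)(n+N+1)²). With N = 2k+2 each term of the series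
is a moment, and termwise integration (`hasSum_oddHarmonicSum`) turns the sum into -3 ∫₀¹
arctan²x/(1+x²) · w_N(x) dx. In ℝ, `HasSum` already means absolute convergence.

This integral is evaluated by alternating two reductions. Dividing x^(2k+2) by 1+x² leaves the
moments of arctan² and arctan²·log; integration by parts turns these into integrals of
x^(2m+1)/(1+x²) against arctan and arctan·log; a second division and a second integration by parts
end at ∫ x^n/(1+x²) and ∫ x^n log x/(1+x²), which are differences of digamma and trigamma values.
`blockA_eq` and `blockB_eq` identify A_{k,j} and B_{k,j} with the intermediate integrals.

The remainders of the two divisions leave four constants. ∫ arctan²/(1+x²) and ∫ x arctan x/(1+x²)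
are elementary once Catalan's constant is available. ∫ arctan²x log x/(1+x²) = ∫ θ² log tan θ over
[0, π/4] comes from the Fourier series of log tan θ and brings in β(4). ∫ x arctan x log x/(1+x²) is
the deep one: by parts it reduces to ∫ log(1+x²) arctan x/x and ∫ log x log(1+x²)/(1+x²). Both are
reached through explicit trilogarithm antiderivatives (`integral_log_one_add_sq_mul_arctan_div`,
`integral_log_one_add_sq_sub_sq`), together with the duplication formula for sin 2θ, and this is
where W(3) arises. -/

/-! ### Integration by parts against x^n and x^n log x -/

theorem intervalIntegrable_mul_log {g : ℝ → ℝ} (hg : Continuous g) (a b : ℝ) :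
    IntervalIntegrable (fun x => g x * log x) volume a b :=
  intervalIntegrable_log'.continuousOn_mul hg.continuousOn

theorem continuous_pow_succ_mul_log (n : ℕ) : Continuous fun x : ℝ => x ^ (n + 1) * log x := by
  have : (fun x : ℝ => x ^ (n + 1) * log x) = fun x => x ^ n * (x * log x) := by
    ext x; ring
  rw [this]
  exact (continuous_pow n).mul continuous_mul_log

theorem integral_pow_mul_eq {g g' : ℝ → ℝ} (hg : ∀ x, HasDerivAt g (g' x) x)
    (hg' : Continuous g') (n : ℕ) :
    ∫ x in (0 : ℝ)..1, x ^ n * g x = (g 1 - ∫ x in (0 : ℝ)..1, x ^ (n + 1) * g' x) / (n + 1) := by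
  have hgc : Continuous g := continuous_iff_continuousAt.2 fun x => (hg x).continuousAt
  have hn : (n : ℝ) + 1 ≠ 0 := by positivity
  have h := integral_eq_sub_of_hasDerivAt (a := 0) (b := 1) (f := fun x => x ^ (n + 1) * g x)
    (f' := fun x => (n + 1) * (x ^ n * g x) + x ^ (n + 1) * g' x)
    (fun x _ => by
      refine ((hasDerivAt_pow (n + 1) x).fun_mul (hg x)).congr_deriv ?_
      push_cast; ring)
    (by apply Continuous.intervalIntegrable; fun_prop)
  rw [intervalIntegral.integral_add (by apply Continuous.intervalIntegrable; fun_prop)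
    (by apply Continuous.intervalIntegrable; fun_prop),
    intervalIntegral.integral_const_mul] at h
  rw [eq_div_iff hn]
  simp at h
  linarith

/-- Integrate the derivative of x^(n+1) log x · g, which is continuous on [0,1] and vanishes at both
ends; the log-free integral of x^n g that appears is then integrated by parts once more. -/
theorem integral_pow_mul_log_mul_eq {g g' : ℝ → ℝ} (hg : ∀ x, HasDerivAt g (g' x) x)
    (hg' : Continuous g') (n : ℕ) :
    ∫ x in (0 : ℝ)..1, x ^ n * g x * log x =
      -(g 1 - ∫ x in (0 : ℝ)..1, x ^ (n + 1) * g' x) / (n + 1) ^ 2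
        - (∫ x in (0 : ℝ)..1, x ^ (n + 1) * g' x * log x) / (n + 1) := by
  have hgc : Continuous g := continuous_iff_continuousAt.2 fun x => (hg x).continuousAt
  have hn : (n : ℝ) + 1 ≠ 0 := by positivity
  have i1 : IntervalIntegrable (fun x => (n + 1) * (x ^ n * g x * log x)) volume 0 1 :=
    (intervalIntegrable_mul_log (by fun_prop) 0 1).const_mul _
  have i2 : IntervalIntegrable (fun x => x ^ (n + 1) * g' x * log x) volume 0 1 :=
    intervalIntegrable_mul_log (by fun_prop) 0 1
  have i3 : IntervalIntegrable (fun x => x ^ n * g x) volume 0 1 := by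
    apply Continuous.intervalIntegrable; fun_prop
  have h := integral_eq_sub_of_hasDerivAt_of_le (a := 0) (b := 1) zero_le_one
    (f := fun x => x ^ (n + 1) * log x * g x)
    (f' := fun x => (n + 1) * (x ^ n * g x * log x) + x ^ (n + 1) * g' x * log x + x ^ n * g x)
    ((continuous_pow_succ_mul_log n).mul hgc).continuousOn
    (fun x hx => by
      have hx0 : x ≠ 0 := hx.1.ne'
      refine (((hasDerivAt_pow (n + 1) x).fun_mul (hasDerivAt_log hx0)).fun_mul (hg x)).congr_deriv ?_
      push_cast; field_simp; ring)
    ((i1.add i2).add i3)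
  rw [intervalIntegral.integral_add (i1.add i2) i3, intervalIntegral.integral_add i1 i2,
    intervalIntegral.integral_const_mul, integral_pow_mul_eq hg hg'] at h
  simp at h
  field_simp at h ⊢
  linear_combination h

theorem integral_pow_mul_log (n : ℕ) :
    ∫ x in (0 : ℝ)..1, x ^ n * log x = -1 / ((n : ℝ) + 1) ^ 2 := by
  have h := integral_pow_mul_log_mul_eq (g := fun _ => 1) (g' := fun _ => 0)
    (fun x => hasDerivAt_const x 1) continuous_const n
  simpa using h

/-! ### Polynomial division by 1 + x² -/

/-- Division of `x ^ (n + 2 m)` by `1 + x ^ 2`. -/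
theorem pow_add_two_mul_div (n m : ℕ) (x : ℝ) :
    x ^ (n + 2 * m) / (1 + x ^ 2) =
      ∑ j ∈ Finset.Icc 1 m, (-1 : ℝ) ^ (j + 1) * x ^ (n + 2 * (m - j))
        + (-1) ^ m * (x ^ n / (1 + x ^ 2)) := by
  have hx : (1 : ℝ) + x ^ 2 ≠ 0 := by positivity
  have key : ∀ m : ℕ, ∑ j ∈ Finset.Icc 1 m, (-1 : ℝ) ^ (j + 1) * x ^ (n + 2 * (m - j))
      = ∑ i ∈ Finset.range m, (-1 : ℝ) ^ (m - 1 - i) * x ^ (n + 2 * i) := by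
    intro m
    rw [Finset.range_eq_Ico, Finset.sum_bij' (fun j _ => m - j) (fun i _ => m - i)]
    · intro j hj; simp at hj ⊢; omega
    · intro j hj; simp at hj ⊢; omega
    · intro j hj; simp at hj ⊢; omega
    · intro j hj; simp at hj ⊢; omega
    · intro j hj
      simp at hj
      congr 1
      rw [show j + 1 = (m - 1 - (m - j)) + 2 by omega, pow_add]; simp
  rw [key]
  clear key
  have h : ∀ m : ℕ, ∑ i ∈ Finset.range m, (-1 : ℝ) ^ (m - 1 - i) * x ^ (n + 2 * i)
      = -(-1) ^ m * ∑ i ∈ Finset.range m, (-1 : ℝ) ^ i * x ^ (n + 2 * i) := by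
    intro m
    rw [Finset.mul_sum]
    refine Finset.sum_congr rfl fun i hi => ?_
    simp at hi
    obtain ⟨t, rfl⟩ : ∃ t, m = i + t + 1 := ⟨m - i - 1, by omega⟩
    have h3 : ((-1 : ℝ) ^ i) * (-1) ^ i = 1 := by rw [← mul_pow]; simp
    rw [show i + t + 1 - 1 - i = t by omega, pow_succ, pow_add (-1 : ℝ) i t]
    linear_combination (-((-1) ^ t * x ^ (n + 2 * i))) * h3
  rw [h]
  clear h
  -- Up to the factor x^n this is the finite geometric sum with ratio -x².
  have h2 : (∑ i ∈ Finset.range m, (-1 : ℝ) ^ i * x ^ (n + 2 * i)) * (1 + x ^ 2)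
      = x ^ n - (-1) ^ m * x ^ (n + 2 * m) := by
    induction m with
    | zero => simp
    | succ m ih => rw [Finset.sum_range_succ, add_mul, ih]; ring
  have h3 : ((-1 : ℝ) ^ m) * (-1) ^ m = 1 := by rw [← mul_pow]; simp
  rw [div_eq_iff hx, add_mul, mul_assoc, h2, mul_assoc, div_mul_cancel₀ _ hx]
  linear_combination (-x ^ (n + 2 * m)) * h3

theorem integral_pow_add_two_mul_div {g : ℝ → ℝ} (hg : IntervalIntegrable g volume 0 1) (n m : ℕ) :
    ∫ x in (0 : ℝ)..1, x ^ (n + 2 * m) / (1 + x ^ 2) * g x =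
      ∑ j ∈ Finset.Icc 1 m, (-1 : ℝ) ^ (j + 1) * (∫ x in (0 : ℝ)..1, x ^ (n + 2 * (m - j)) * g x)
        + (-1) ^ m * ∫ x in (0 : ℝ)..1, x ^ n / (1 + x ^ 2) * g x := by
  have h : ∀ f : ℝ → ℝ, Continuous f → IntervalIntegrable (fun x => f x * g x) volume 0 1 :=
    fun f hf => hg.continuousOn_mul hf.continuousOn
  have hc : Continuous fun x : ℝ => x ^ n / (1 + x ^ 2) :=
    (continuous_pow n).div (by fun_prop) fun x => by positivity
  simp_rw [pow_add_two_mul_div n m, add_mul, Finset.sum_mul]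
  rw [intervalIntegral.integral_add, intervalIntegral.integral_finsetSum]
  · simp_rw [mul_assoc, intervalIntegral.integral_const_mul]
  · exact fun j _ => h _ (by fun_prop)
  · simp_rw [← Finset.sum_mul]
    exact h _ (by fun_prop)
  · exact h _ (hc.const_mul _)

/-! ### Digamma and trigamma differences at distance 1/2 -/

theorem differentiableAt_Gamma_of_pos {x : ℝ} (hx : 0 < x) : DifferentiableAt ℝ Gamma x :=
  differentiableAt_Gamma fun m => by
    have : (0 : ℝ) ≤ m := m.cast_nonneg
    linarith

/-- The complex Gamma function is holomorphic on the right half plane, hence smooth there, and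
smoothness passes to its restriction to the real line. -/
theorem contDiffAt_Gamma_of_pos {x : ℝ} (hx : 0 < x) (n : ℕ) : ContDiffAt ℝ n Gamma x := by
  have h : ContDiffAt ℂ n Complex.Gamma (x : ℂ) := by
    have ho : IsOpen {z : ℂ | 0 < z.re} := isOpen_lt continuous_const Complex.continuous_re
    have hd : DifferentiableOn ℂ Complex.Gamma {z : ℂ | 0 < z.re} := fun z hz =>
      (Complex.differentiableAt_Gamma z fun m hm => by
        have h1 : z.re = -(m : ℝ) := by rw [hm]; simp
        have : (0 : ℝ) ≤ m := m.cast_nonneg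
        have hz' : 0 < z.re := hz
        linarith).differentiableWithinAt
    exact (hd.contDiffOn ho).contDiffAt (ho.mem_nhds (by simpa using hx))
  exact h.real_of_complex

theorem digamma_eq_deriv_log_Gamma {x : ℝ} (hx : 0 < x) :
    HasDerivAt (log ∘ Gamma) (logDeriv Gamma x) x := by
  have := (differentiableAt_Gamma_of_pos hx).hasDerivAt.log (Gamma_pos_of_pos hx).ne'
  exact this

theorem differentiableAt_digamma {x : ℝ} (hx : 0 < x) :
    DifferentiableAt ℝ (logDeriv Gamma) x := by
  have h1 : DifferentiableAt ℝ (deriv Gamma) x :=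
    ((contDiffAt_Gamma_of_pos hx 2).derivWithin (m := 1) (by norm_num)).differentiableAt (by simp)
  exact h1.div (differentiableAt_Gamma_of_pos hx) (Gamma_pos_of_pos hx).ne'

theorem digamma_add_one {x : ℝ} (hx : 0 < x) :
    logDeriv Gamma (x + 1) = logDeriv Gamma x + 1 / x := by
  have h1 : HasDerivAt (fun y => (log ∘ Gamma) (y + 1)) (logDeriv Gamma (x + 1)) x := by
    simpa using (digamma_eq_deriv_log_Gamma (x := x + 1) (by linarith)).comp_add_const x 1
  have h2 : HasDerivAt (fun y => (log ∘ Gamma) y + log y) (logDeriv Gamma x + 1 / x) x := by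
    rw [one_div]
    exact (digamma_eq_deriv_log_Gamma hx).fun_add (hasDerivAt_log hx.ne')
  refine h1.unique (h2.congr_of_eventuallyEq ?_)
  filter_upwards [lt_mem_nhds hx] with y hy
  rw [Function.comp_apply, Function.comp_apply, Gamma_add_one hy.ne',
    log_mul hy.ne' (Gamma_pos_of_pos hy).ne', add_comm]

/-- Log-convexity of Γ. Monotonicity is what bounds ψ(y + 1/2) - ψ(y) without any asymptotic
expansion of ψ. -/
theorem monotoneOn_digamma : MonotoneOn (logDeriv Gamma) (Ioi 0) := by
  have h := convexOn_log_Gamma.monotoneOn_deriv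
    (fun x hx => (digamma_eq_deriv_log_Gamma hx).differentiableAt)
  intro x hx y hy hxy
  have := h hx hy hxy
  rwa [(digamma_eq_deriv_log_Gamma hx).deriv, (digamma_eq_deriv_log_Gamma hy).deriv] at this

/-- The telescoping series of `ψ (x + 1 / 2) - ψ x`. -/
theorem hasSum_digamma_sub {x : ℝ} (hx : 0 < x) :
    HasSum (fun n : ℕ => 1 / (x + n) - 1 / (x + n + 1 / 2))
      (logDeriv Gamma (x + 1 / 2) - logDeriv Gamma x) := by
  set D : ℝ → ℝ := fun y => logDeriv Gamma (y + 1 / 2) - logDeriv Gamma y with hD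
  have hpos : ∀ n : ℕ, 0 < x + n := fun n => by positivity
  have hrec : ∀ n : ℕ, 1 / (x + n) - 1 / (x + n + 1 / 2) = D (x + n) - D (x + (n + 1 : ℕ)) := by
    intro n
    have h1 := digamma_add_one (hpos n)
    have h2 := digamma_add_one (x := x + n + 1 / 2) (by linarith [hpos n])
    simp only [hD]
    push_cast
    rw [show x + (n + 1) + 1 / 2 = x + n + 1 / 2 + 1 by ring, ← add_assoc, h1, h2]
    ring
  have hnn : ∀ n : ℕ, 0 ≤ 1 / (x + n) - 1 / (x + n + 1 / 2) := fun n =>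
    sub_nonneg.2 (one_div_le_one_div_of_le (hpos n) (by linarith))
  rw [hasSum_iff_tendsto_nat_of_nonneg hnn]
  simp_rw [hrec, Finset.sum_range_sub' (fun n : ℕ => D (x + n))]
  -- Monotonicity gives 0 ≤ D(y) ≤ ψ(y+1) - ψ(y) = 1/y at y = x + n.
  have hlim : Tendsto (fun n : ℕ => D (x + n)) atTop (𝓝 0) := by
    have hb : Tendsto (fun n : ℕ => 1 / (x + n)) atTop (𝓝 0) := by
      simp_rw [one_div]
      exact (tendsto_atTop_add_const_left _ _ tendsto_natCast_atTop_atTop).inv_tendsto_atTop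
    refine squeeze_zero (fun n => ?_) (fun n => ?_) hb
    · exact sub_nonneg.2 (monotoneOn_digamma (hpos n) (by simp; linarith [hpos n]) (by linarith))
    · have := monotoneOn_digamma (a := x + n + 1 / 2) (b := x + n + 1)
        (by simp; linarith [hpos n]) (by simp; linarith [hpos n]) (by linarith)
      rw [digamma_add_one (hpos n)] at this
      simp only [hD]; linarith
  simpa [hD] using hlim.const_sub (D x)

/-- The termwise derivative of the series of `ψ (x + 1 / 2) - ψ x`. -/
theorem hasSum_trigamma_sub {x : ℝ} (hx : 0 < x) :
    HasSum (fun n : ℕ => -1 / (x + n) ^ 2 + 1 / (x + n + 1 / 2) ^ 2)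
      (deriv (logDeriv Gamma) (x + 1 / 2) - deriv (logDeriv Gamma) x) := by
  -- On the half-line beyond x/2, a neighbourhood of x that stays away from 0, the differentiated
  -- terms have the uniform summable majorant 2/(x/2 + n)².
  have hc : 0 < x / 2 := by linarith
  have hu : Summable fun n : ℕ => 2 * (1 / (x / 2 + n) ^ 2) := by
    have := (Real.summable_one_div_nat_add_rpow (x / 2) 2).2 (by norm_num)
    refine (this.congr fun n => ?_).mul_left 2
    rw [abs_of_pos (by positivity), add_comm]; norm_num
  have hb : ∀ (n : ℕ) (y : ℝ), y ∈ Ioi (x / 2) →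
      ‖-1 / (y + n) ^ 2 + 1 / (y + n + 1 / 2) ^ 2‖ ≤ 2 * (1 / (x / 2 + n) ^ 2) := by
    intro n y hy
    have hy' : x / 2 < y := hy
    have hp : 0 < x / 2 + n := by positivity
    have e1 : 1 / (y + n) ^ 2 ≤ 1 / (x / 2 + n) ^ 2 := by gcongr
    have e2 : 1 / (y + n + 1 / 2) ^ 2 ≤ 1 / (x / 2 + n) ^ 2 :=
      one_div_le_one_div_of_le (by positivity) (pow_le_pow_left₀ hp.le (by linarith) 2)
    have p1 : 0 ≤ 1 / (y + n) ^ 2 := by positivity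
    have p2 : 0 ≤ 1 / (y + n + 1 / 2) ^ 2 := by positivity
    rw [Real.norm_eq_abs, abs_le, neg_div]
    constructor <;> linarith
  have hd : ∀ (n : ℕ) (y : ℝ), y ∈ Ioi (x / 2) →
      HasDerivAt (fun y : ℝ => 1 / (y + n) - 1 / (y + n + 1 / 2))
        (-1 / (y + n) ^ 2 + 1 / (y + n + 1 / 2) ^ 2) y := by
    intro n y hy
    have hy' : 0 < y := hc.trans hy
    have a1 : HasDerivAt (fun y : ℝ => (y + n)⁻¹) (-1 / (y + n) ^ 2) y :=
      ((hasDerivAt_id y).add_const _).inv (by simp; positivity)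
    have a2 : HasDerivAt (fun y : ℝ => (y + n + 1 / 2)⁻¹) (-1 / (y + n + 1 / 2) ^ 2) y :=
      (((hasDerivAt_id y).add_const _).add_const _).inv (by simp; positivity)
    simp only [one_div] at a1 a2 ⊢
    refine (a1.sub a2).congr_deriv ?_
    rw [neg_div, neg_div]; simp
  have hx2 : x ∈ Ioi (x / 2) := by simp; linarith
  have hD := hasDerivAt_tsum_of_isPreconnected hu isOpen_Ioi isPreconnected_Ioi hd hb hx2
    (hasSum_digamma_sub hx).summable hx2
  have hs : Summable fun n : ℕ => -1 / (x + n) ^ 2 + 1 / (x + n + 1 / 2) ^ 2 :=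
    Summable.of_norm_bounded hu fun n => hb n x hx2
  have hE : HasDerivAt (fun y => logDeriv Gamma (y + 1 / 2) - logDeriv Gamma y)
      (deriv (logDeriv Gamma) (x + 1 / 2) - deriv (logDeriv Gamma) x) x :=
    ((differentiableAt_digamma (x := x + 1 / 2) (by linarith)).hasDerivAt.comp_add_const x _).sub
      (differentiableAt_digamma hx).hasDerivAt
  have heq : (fun y => ∑' n : ℕ, (1 / (y + n) - 1 / (y + n + 1 / 2)))
      =ᶠ[𝓝 x] fun y => logDeriv Gamma (y + 1 / 2) - logDeriv Gamma y := by
    filter_upwards [lt_mem_nhds hx] with y hy using (hasSum_digamma_sub hy).tsum_eq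
  rw [(hE.congr_of_eventuallyEq heq).unique hD]
  exact hs.hasSum

/-! ### Termwise integration and the integrals of x^n/(1+x²), with and without log x -/

/-- Termwise integration over `[0, 1]` of a series whose terms have constant sign. -/
theorem hasSum_mul_integral_zero_one {c : ℕ → ℝ} {g : ℕ → ℝ → ℝ} {F : ℝ → ℝ}
    (hg : ∀ n, IntervalIntegrable (g n) volume 0 1)
    (h0 : ∀ n, ∀ x ∈ Ioo (0 : ℝ) 1, 0 ≤ g n x)
    (hF : ∀ x ∈ Ioo (0 : ℝ) 1, HasSum (fun n => c n * g n x) (F x))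
    (hs : Summable fun n => c n * ∫ x in (0 : ℝ)..1, g n x) :
    HasSum (fun n => c n * ∫ x in (0 : ℝ)..1, g n x) (∫ x in (0 : ℝ)..1, F x) := by
  have hI : ∀ f : ℝ → ℝ, ∫ x in (0 : ℝ)..1, f x = ∫ x in Ioo (0 : ℝ) 1, f x := fun f => by
    rw [integral_of_le zero_le_one, integral_Ioc_eq_integral_Ioo]
  have hgi : ∀ n, IntegrableOn (g n) (Ioo 0 1) := fun n =>
    (intervalIntegrable_iff_integrableOn_Ioo_of_le zero_le_one).1 (hg n)
  -- Since `g n` is nonnegative, the L¹ norm of a term is the absolute value of its integral, so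
  -- `hs` is exactly the hypothesis of the L¹ summation theorem.
  have hnorm : ∀ n, ∫ x in Ioo (0 : ℝ) 1, ‖c n * g n x‖ = |c n * ∫ x in (0 : ℝ)..1, g n x| := by
    intro n
    rw [hI, abs_mul, abs_of_nonneg (setIntegral_nonneg measurableSet_Ioo (h0 n)),
      ← MeasureTheory.integral_const_mul]
    refine setIntegral_congr_fun measurableSet_Ioo fun x hx => ?_
    simp only [norm_mul, Real.norm_eq_abs, abs_of_nonneg (h0 n x hx)]
  have h := hasSum_integral_of_summable_integral_norm
    (μ := volume.restrict (Ioo (0 : ℝ) 1)) (F := fun n x => c n * g n x)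
    (fun n => (hgi n).const_mul _) (by simp_rw [hnorm]; exact hs.abs)
  rw [hI F, setIntegral_congr_fun measurableSet_Ioo fun x hx => (hF x hx).tsum_eq.symm]
  simpa only [MeasureTheory.integral_const_mul, hI] using h

theorem continuous_one_add_sq_inv : Continuous fun x : ℝ => (1 + x ^ 2)⁻¹ :=
  Continuous.inv₀ (by fun_prop) fun x => by positivity

theorem continuous_pow_div_one_add_sq (n : ℕ) : Continuous fun x : ℝ => x ^ n / (1 + x ^ 2) :=
  (continuous_pow n).div (by fun_prop) fun x => by positivity

/-- `∑ x ^ (n + 4 m) (1 - x ^ 2) = x ^ n / (1 + x ^ 2)`. -/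
theorem hasSum_pow_mul_one_sub_sq {x : ℝ} (hx : x ∈ Ioo (0 : ℝ) 1) (n : ℕ) :
    HasSum (fun m : ℕ => x ^ (n + 4 * m) * (1 - x ^ 2)) (x ^ n / (1 + x ^ 2)) := by
  have h4 : x ^ 4 < 1 := pow_lt_one₀ hx.1.le hx.2 (by norm_num)
  have h2 : x ^ 2 < 1 := pow_lt_one₀ hx.1.le hx.2 (by norm_num)
  have h := (hasSum_geometric_of_lt_one (by positivity) h4).mul_left (x ^ n * (1 - x ^ 2))
  convert! h using 1
  · ext m; rw [pow_add, pow_mul]; ring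
  · have : 1 - x ^ 4 = (1 - x ^ 2) * (1 + x ^ 2) := by ring
    have h5 : 1 - x ^ 2 ≠ 0 := by linarith
    rw [this]; field_simp

/-- Consecutive terms of the geometric series are paired into x^(n+4m)(1-x²) ≥ 0, whose integrals
are the terms of `hasSum_digamma_sub` at (n+1)/4. Unpaired, the integrated series would converge
only conditionally. -/
theorem integral_pow_div_one_add_sq (n : ℕ) :
    ∫ x in (0 : ℝ)..1, x ^ n / (1 + x ^ 2) =
      (logDeriv Gamma (((n : ℝ) + 3) / 4) - logDeriv Gamma (((n : ℝ) + 1) / 4)) / 4 := by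
  have hi : ∀ m : ℕ, ∫ x in (0 : ℝ)..1, x ^ (n + 4 * m) * (1 - x ^ 2)
      = (1 / (((n : ℝ) + 1) / 4 + m) - 1 / (((n : ℝ) + 1) / 4 + m + 1 / 2)) / 4 := by
    intro m
    simp_rw [mul_sub, mul_one, ← pow_add]
    rw [intervalIntegral.integral_sub (by simp) (by simp), integral_pow, integral_pow]
    have h1 : ((n : ℝ) + 1) / 4 + m ≠ 0 := by positivity
    have h2 : ((n : ℝ) + 1) / 4 + m + 1 / 2 ≠ 0 := by positivity
    push_cast
    simp
    field_simp
    ring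
  have hψ := (hasSum_digamma_sub (x := ((n : ℝ) + 1) / 4) (by positivity)).div_const 4
  rw [show ((n : ℝ) + 1) / 4 + 1 / 2 = ((n : ℝ) + 3) / 4 by ring] at hψ
  have h := hasSum_mul_integral_zero_one (c := fun _ => 1)
    (g := fun m x => x ^ (n + 4 * m) * (1 - x ^ 2)) (F := fun x => x ^ n / (1 + x ^ 2))
    (fun m => by apply Continuous.intervalIntegrable; fun_prop)
    (fun m x hx => mul_nonneg (pow_nonneg hx.1.le _)
      (sub_nonneg.2 (pow_le_one₀ hx.1.le hx.2.le)))
    (fun x hx => by simpa using hasSum_pow_mul_one_sub_sq hx n)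
    (by simp_rw [one_mul, hi]; exact hψ.summable)
  simp_rw [one_mul, hi] at h
  exact h.unique hψ

theorem integral_pow_div_one_add_sq_mul_log (n : ℕ) :
    ∫ x in (0 : ℝ)..1, x ^ n / (1 + x ^ 2) * log x =
      (deriv (logDeriv Gamma) (((n : ℝ) + 3) / 4)
        - deriv (logDeriv Gamma) (((n : ℝ) + 1) / 4)) / 16 := by
  have hi : ∀ m : ℕ, -1 * ∫ x in (0 : ℝ)..1, -(x ^ (n + 4 * m) * (1 - x ^ 2) * log x)
      = (-1 / (((n : ℝ) + 1) / 4 + m) ^ 2 + 1 / (((n : ℝ) + 1) / 4 + m + 1 / 2) ^ 2) / 16 := by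
    intro m
    simp_rw [mul_sub, mul_one, ← pow_add, sub_mul]
    rw [intervalIntegral.integral_neg, intervalIntegral.integral_sub
      (intervalIntegrable_mul_log (by fun_prop) 0 1) (intervalIntegrable_mul_log (by fun_prop) 0 1),
      integral_pow_mul_log, integral_pow_mul_log]
    have h1 : ((n : ℝ) + 1) / 4 + m ≠ 0 := by positivity
    have h2 : ((n : ℝ) + 1) / 4 + m + 1 / 2 ≠ 0 := by positivity
    have h3 : ((n : ℝ) + 4 * m + 1) ≠ 0 := by positivity
    have h4 : ((n : ℝ) + 4 * m + 2 + 1) ≠ 0 := by positivity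
    rw [show ((n : ℝ) + 1) / 4 + m = (n + 4 * m + 1) / 4 by ring,
      show ((n : ℝ) + 4 * m + 1) / 4 + 1 / 2 = (n + 4 * m + 2 + 1) / 4 by ring]
    push_cast
    field_simp
    ring
  have hψ := (hasSum_trigamma_sub (x := ((n : ℝ) + 1) / 4) (by positivity)).div_const 16
  rw [show ((n : ℝ) + 1) / 4 + 1 / 2 = ((n : ℝ) + 3) / 4 by ring] at hψ
  -- On (0,1) log x is negative; the sign goes into the coefficient so that the integrands are
  -- nonnegative.
  have h := hasSum_mul_integral_zero_one (c := fun _ => -1)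
    (g := fun m x => -(x ^ (n + 4 * m) * (1 - x ^ 2) * log x))
    (F := fun x => x ^ n / (1 + x ^ 2) * log x)
    (fun m => (intervalIntegrable_mul_log (by fun_prop) 0 1).neg)
    (fun m x hx => neg_nonneg.2 (mul_nonpos_of_nonneg_of_nonpos (mul_nonneg (pow_nonneg hx.1.le _)
      (sub_nonneg.2 (pow_le_one₀ hx.1.le hx.2.le))) (log_nonpos hx.1.le hx.2.le)))
    (fun x hx => by simpa using (hasSum_pow_mul_one_sub_sq hx n).mul_right (log x))
    (by simp_rw [hi]; exact hψ.summable)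
  simp_rw [hi] at h
  exact h.unique hψ

/-! ### Integrability and moments of log² -/

/-- Writing x log²x = 4(√x log √x)² reduces continuity at 0 to that of y log y. -/
theorem continuousOn_mul_log_sq : ContinuousOn (fun x : ℝ => x * log x ^ 2) (Icc 0 1) := by
  have h : Continuous fun x : ℝ => 4 * (√x * log √x) ^ 2 :=
    ((continuous_mul_log.comp continuous_sqrt).pow 2).const_mul 4
  refine h.continuousOn.congr fun x hx => ?_
  simp only [log_sqrt hx.1, mul_pow, sq_sqrt hx.1]
  ring

/-- The function x log²x - 2x log x + 2x is continuous on [0,1] with derivative log²x ≥ 0, and a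
nonnegative derivative of such a function is integrable. -/
theorem intervalIntegrable_log_sq : IntervalIntegrable (fun x : ℝ => log x ^ 2) volume 0 1 := by
  rw [intervalIntegrable_iff_integrableOn_Ioc_of_le zero_le_one]
  refine integrableOn_deriv_of_nonneg (g := fun x => x * log x ^ 2 - 2 * (x * log x) + 2 * x)
    ((continuousOn_mul_log_sq.sub (continuous_mul_log.const_mul 2).continuousOn).add
      (by fun_prop)) (fun x hx => ?_) (fun x _ => sq_nonneg _)
  have hx0 : x ≠ 0 := hx.1.ne'
  refine ((((hasDerivAt_id x).fun_mul ((hasDerivAt_log hx0).pow 2)).fun_sub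
    (((hasDerivAt_id x).fun_mul (hasDerivAt_log hx0)).const_mul 2)).fun_add
    ((hasDerivAt_id x).const_mul 2)).congr_deriv ?_
  simp
  field_simp
  ring

theorem intervalIntegrable_mul_log_sq {g : ℝ → ℝ} (hg : Continuous g) :
    IntervalIntegrable (fun x => g x * log x ^ 2) volume 0 1 :=
  intervalIntegrable_log_sq.continuousOn_mul hg.continuousOn

theorem integral_pow_mul_log_sq (n : ℕ) :
    ∫ x in (0 : ℝ)..1, x ^ n * log x ^ 2 = 2 / ((n : ℝ) + 1) ^ 3 := by
  have hn : (n : ℝ) + 1 ≠ 0 := by positivity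
  have i1 : IntervalIntegrable (fun x : ℝ => (n + 1) * (x ^ n * log x ^ 2)) volume 0 1 :=
    (intervalIntegrable_mul_log_sq (by fun_prop)).const_mul _
  have i2 : IntervalIntegrable (fun x : ℝ => 2 * (x ^ n * log x)) volume 0 1 :=
    (intervalIntegrable_mul_log (by fun_prop) 0 1).const_mul _
  have h := integral_eq_sub_of_hasDerivAt_of_le (a := 0) (b := 1) zero_le_one
    (f := fun x => x ^ n * (x * log x ^ 2))
    (f' := fun x => (n + 1) * (x ^ n * log x ^ 2) + 2 * (x ^ n * log x))
    ((continuous_pow n).continuousOn.mul continuousOn_mul_log_sq)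
    (fun x hx => by
      have hx0 : x ≠ 0 := hx.1.ne'
      have h1 : HasDerivAt (fun x => x ^ (n + 1) * log x ^ 2)
        ((n + 1) * (x ^ n * log x ^ 2) + 2 * (x ^ n * log x)) x := by
        refine ((hasDerivAt_pow (n + 1) x).fun_mul ((hasDerivAt_log hx0).fun_pow 2)).congr_deriv ?_
        push_cast
        simp
        field_simp
        ring
      exact h1.congr_of_eventuallyEq (Eventually.of_forall fun y => by ring))
    (i1.add i2)
  rw [intervalIntegral.integral_add i1 i2, intervalIntegral.integral_const_mul,
    intervalIntegral.integral_const_mul, integral_pow_mul_log] at h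
  simp at h
  field_simp at h ⊢
  linear_combination h

/-! ### Integrals evaluated by power series: G, β(3) and π² -/

theorem hasSum_neg_one_pow_mul_pow {x : ℝ} (hx : x ∈ Ioo (0 : ℝ) 1) :
    HasSum (fun m : ℕ => (-1 : ℝ) ^ m * x ^ (2 * m)) (1 / (1 + x ^ 2)) := by
  have h2 : |(-x ^ 2)| < 1 := by
    rw [abs_neg, abs_of_nonneg (by positivity)]
    exact pow_lt_one₀ hx.1.le hx.2 (by norm_num)
  convert! hasSum_geometric_of_abs_lt_one h2 using 1
  · ext m; rw [neg_pow (x ^ 2), pow_mul]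
  · rw [one_div, sub_neg_eq_add]

theorem summable_neg_one_pow_div_odd_pow {s : ℕ} (hs : 2 ≤ s) :
    Summable fun n : ℕ => (-1 : ℝ) ^ n / (2 * (n : ℝ) + 1) ^ s := by
  have h : Summable fun n : ℕ => 1 / ((n : ℝ) + 1) ^ s := by
    have := (summable_nat_add_iff 1).2 (Real.summable_one_div_nat_pow.2 (show 1 < s by omega))
    simpa using this
  refine Summable.of_norm_bounded h fun n => ?_
  rw [norm_div, norm_pow, norm_neg, norm_one, one_pow, Real.norm_of_nonneg (by positivity)]
  exact one_div_le_one_div_of_le (by positivity) (pow_le_pow_left₀ (by positivity)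
    (by linarith [n.cast_nonneg (α := ℝ)]) s)

theorem hasSum_dirichletBeta {s : ℕ} (hs : 2 ≤ s) :
    HasSum (fun n : ℕ => (-1 : ℝ) ^ n / (2 * (n : ℝ) + 1) ^ s) (ArctanSums.dirichletBeta s) :=
  (summable_neg_one_pow_div_odd_pow hs).hasSum

/-- Mathlib's value of Σ sin(πn/2)/n³ is this series: even n contribute nothing and sin(π(2n+1)/2) =
(-1)^n. -/
theorem dirichletBeta_three : ArctanSums.dirichletBeta 3 = π ^ 3 / 32 := by
  have h := hasSum_L_function_mod_four_eval_three
  have hinj : Function.Injective fun n : ℕ => 2 * n + 1 := fun a b h => by simpa using h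
  rw [← hinj.hasSum_iff] at h
  · refine (hasSum_dirichletBeta (by norm_num)).unique ?_
    convert! h using 1
    ext n
    simp only [Function.comp]
    push_cast
    rw [show π * (2 * (n : ℝ) + 1) / 2 = n * π + π / 2 by ring, sin_add_pi_div_two,
      cos_nat_mul_pi]
    ring
  · intro n hn
    have he : Even n := by
      by_contra h
      rw [Nat.not_even_iff_odd] at h
      obtain ⟨m, rfl⟩ := h
      exact hn ⟨m, rfl⟩
    obtain ⟨m, rfl⟩ := he
    have : π * ((m + m : ℕ) : ℝ) / 2 = m * π := by push_cast; ring
    rw [this, sin_nat_mul_pi, mul_zero]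

theorem integral_log_div_one_add_sq :
    ∫ x in (0 : ℝ)..1, log x / (1 + x ^ 2) = -ArctanSums.catalan := by
  have hi : ∀ m : ℕ, -(-1 : ℝ) ^ m * ∫ x in (0 : ℝ)..1, -(x ^ (2 * m) * log x)
      = -((-1) ^ m / (2 * (m : ℝ) + 1) ^ 2) := by
    intro m
    rw [intervalIntegral.integral_neg, integral_pow_mul_log]
    push_cast; ring
  have hβ := (hasSum_dirichletBeta (s := 2) le_rfl).neg
  have h := hasSum_mul_integral_zero_one (c := fun m => -(-1) ^ m)
    (g := fun m x => -(x ^ (2 * m) * log x)) (F := fun x => log x / (1 + x ^ 2))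
    (fun m => (intervalIntegrable_mul_log (by fun_prop) 0 1).neg)
    (fun m x hx => neg_nonneg.2 (mul_nonpos_of_nonneg_of_nonpos (pow_nonneg hx.1.le _)
      (log_nonpos hx.1.le hx.2.le)))
    (fun x hx => by
      have := (hasSum_neg_one_pow_mul_pow hx).mul_right (log x)
      rw [one_div_mul_eq_div] at this
      convert! this using 2
      ring)
    (by simp_rw [hi]; exact hβ.summable)
  simp_rw [hi] at h
  exact h.unique hβ

theorem integral_log_sq_div_one_add_sq :
    ∫ x in (0 : ℝ)..1, log x ^ 2 / (1 + x ^ 2) = π ^ 3 / 16 := by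
  have hi : ∀ m : ℕ, (-1 : ℝ) ^ m * ∫ x in (0 : ℝ)..1, x ^ (2 * m) * log x ^ 2
      = 2 * ((-1) ^ m / (2 * (m : ℝ) + 1) ^ 3) := by
    intro m
    rw [integral_pow_mul_log_sq]
    push_cast; ring
  have hβ := (hasSum_dirichletBeta (s := 3) (by norm_num)).mul_left 2
  have h := hasSum_mul_integral_zero_one (c := fun m => (-1) ^ m)
    (g := fun m x => x ^ (2 * m) * log x ^ 2) (F := fun x => log x ^ 2 / (1 + x ^ 2))
    (fun m => intervalIntegrable_mul_log_sq (by fun_prop))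
    (fun m x hx => mul_nonneg (pow_nonneg hx.1.le _) (sq_nonneg _))
    (fun x hx => by
      have := (hasSum_neg_one_pow_mul_pow hx).mul_right (log x ^ 2)
      rw [one_div_mul_eq_div] at this
      convert! this using 2
      ring)
    (by simp_rw [hi]; exact hβ.summable)
  simp_rw [hi] at h
  rw [h.unique hβ, dirichletBeta_three]; ring

theorem hasSum_arctan_div {x : ℝ} (hx : x ∈ Ioo (0 : ℝ) 1) :
    HasSum (fun m : ℕ => (-1 : ℝ) ^ m / (2 * (m : ℝ) + 1) * x ^ (2 * m)) (arctan x / x) := by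
  have h := (Real.hasSum_arctan (x := x) (by
    rw [Real.norm_eq_abs, abs_of_pos hx.1]; exact hx.2)).div_const x
  convert! h using 2 with m
  have := hx.1.ne'
  push_cast
  rw [pow_succ]; field_simp

theorem integral_arctan_div : ∫ x in (0 : ℝ)..1, arctan x / x = ArctanSums.catalan := by
  have hi : ∀ m : ℕ, (-1 : ℝ) ^ m / (2 * (m : ℝ) + 1) * ∫ x in (0 : ℝ)..1, x ^ (2 * m)
      = (-1) ^ m / (2 * (m : ℝ) + 1) ^ 2 := by
    intro m
    rw [integral_pow]
    push_cast; simp; field_simp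
  have hβ := hasSum_dirichletBeta (s := 2) le_rfl
  have h := hasSum_mul_integral_zero_one (c := fun m => (-1 : ℝ) ^ m / (2 * (m : ℝ) + 1))
    (g := fun m x => x ^ (2 * m)) (F := fun x => arctan x / x)
    (fun m => by simp) (fun m x hx => pow_nonneg hx.1.le _)
    (fun x hx => hasSum_arctan_div hx) (by simp_rw [hi]; exact hβ.summable)
  simp_rw [hi] at h
  exact h.unique hβ

/-- Split ζ(2) = π²/6: the even denominators (odd m) account for a quarter, π²/24, leaving π²/8 for
the odd ones; the alternating sum is the difference. -/
theorem hasSum_neg_one_pow_div_succ_sq :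
    HasSum (fun m : ℕ => (-1 : ℝ) ^ m / ((m : ℝ) + 1) ^ 2) (π ^ 2 / 12) := by
  have hz : HasSum (fun m : ℕ => 1 / ((m : ℝ) + 1) ^ 2) (π ^ 2 / 6) := by
    have := (hasSum_nat_add_iff' 1).2 hasSum_zeta_two
    simpa using this
  have he : HasSum (fun m : ℕ => 1 / ((2 * m + 1 : ℕ) + 1 : ℝ) ^ 2) (π ^ 2 / 24) := by
    convert! hz.div_const 4 using 1
    · ext m; push_cast; field_simp; ring
    · ring
  have ho : HasSum (fun m : ℕ => 1 / ((2 * m : ℕ) + 1 : ℝ) ^ 2) (π ^ 2 / 8) := by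
    have hs : Summable fun m : ℕ => 1 / ((2 * m : ℕ) + 1 : ℝ) ^ 2 :=
      hz.summable.comp_injective (i := fun m => 2 * m) fun a b h => by simpa using h
    have := HasSum.even_add_odd (f := fun m : ℕ => 1 / ((m : ℝ) + 1) ^ 2) hs.hasSum he
    have h2 := this.unique hz
    rw [show π ^ 2 / 8 = ∑' m : ℕ, 1 / ((2 * m : ℕ) + 1 : ℝ) ^ 2 by linarith]
    exact hs.hasSum
  rw [show π ^ 2 / 12 = π ^ 2 / 8 + -(π ^ 2 / 24) by ring]
  refine HasSum.even_add_odd ?_ ?_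
  · convert! ho using 2 with m; simp
  · convert! he.neg using 2 with m
    rw [pow_succ, pow_mul]; simp [neg_div]

theorem integral_log_one_add_sq_div :
    ∫ x in (0 : ℝ)..1, log (1 + x ^ 2) / x = π ^ 2 / 24 := by
  have hi : ∀ m : ℕ, (-1 : ℝ) ^ m / ((m : ℝ) + 1) * ∫ x in (0 : ℝ)..1, x ^ (2 * m + 1)
      = (-1) ^ m / ((m : ℝ) + 1) ^ 2 / 2 := by
    intro m
    rw [integral_pow]
    push_cast; simp; field_simp; ring
  have hβ := hasSum_neg_one_pow_div_succ_sq.div_const 2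
  have h := hasSum_mul_integral_zero_one (c := fun m => (-1 : ℝ) ^ m / ((m : ℝ) + 1))
    (g := fun m x => x ^ (2 * m + 1)) (F := fun x => log (1 + x ^ 2) / x)
    (fun m => by simp) (fun m x hx => pow_nonneg hx.1.le _)
    (fun x hx => by
      have h2 : |(-x ^ 2)| < 1 := by
        rw [abs_neg, abs_of_nonneg (by positivity)]
        exact pow_lt_one₀ hx.1.le hx.2 (by norm_num)
      have := (hasSum_pow_div_log_of_abs_lt_one h2).neg.div_const x
      rw [neg_neg, sub_neg_eq_add] at this
      convert! this using 2 with m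
      have := hx.1.ne'
      rw [neg_pow (x ^ 2), pow_succ (-1 : ℝ) m, ← pow_mul, show 2 * (m + 1) = 2 * m + 1 + 1 by ring,
        pow_succ x (2 * m + 1)]
      field_simp)
    (by simp_rw [hi]; exact hβ.summable)
  simp_rw [hi] at h
  rw [h.unique hβ]; ring

/-! ### The substitution x = tan θ and duplication -/

theorem image_arctan_Ioo : arctan '' Ioo 0 1 = Ioo 0 (π / 4) := by
  ext y
  constructor
  · rintro ⟨x, hx, rfl⟩
    exact ⟨arctan_zero ▸ arctan_strictMono hx.1, arctan_one ▸ arctan_strictMono hx.2⟩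
  · intro hy
    have h1 : -(π / 2) < y := by linarith [hy.1, pi_pos]
    have h2 : y < π / 2 := by linarith [hy.2, pi_pos]
    refine ⟨tan y, ⟨tan_pos_of_pos_of_lt_pi_div_two hy.1 h2, ?_⟩, arctan_tan h1 h2⟩
    rw [← tan_pi_div_four]
    exact tan_lt_tan_of_lt_of_lt_pi_div_two h1 (by linarith [pi_pos]) hy.2

/-- Change of variables along an injective differentiable map asks nothing of `g`, so integrands
singular at an endpoint, such as log sin θ, are covered. -/
theorem integral_comp_arctan (g : ℝ → ℝ) :
    ∫ x in (0 : ℝ)..1, g (arctan x) / (1 + x ^ 2) = ∫ θ in (0 : ℝ)..(π / 4), g θ := by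
  have h := integral_image_eq_integral_abs_deriv_smul (s := Ioo 0 1) measurableSet_Ioo
    (fun x _ => (hasDerivAt_arctan x).hasDerivWithinAt) arctan_injective.injOn g
  rw [image_arctan_Ioo] at h
  rw [integral_of_le zero_le_one, integral_Ioc_eq_integral_Ioo,
    integral_of_le (by positivity), integral_Ioc_eq_integral_Ioo, h]
  refine setIntegral_congr_fun measurableSet_Ioo fun x _ => ?_
  simp only [smul_eq_mul]
  rw [abs_of_pos (by positivity)]; ring

theorem intervalIntegrable_iff_comp_arctan (g : ℝ → ℝ) :
    IntervalIntegrable g volume 0 (π / 4) ↔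
      IntervalIntegrable (fun x => g (arctan x) / (1 + x ^ 2)) volume 0 1 := by
  have h := integrableOn_image_iff_integrableOn_abs_deriv_smul (s := Ioo 0 1) measurableSet_Ioo
    (fun x _ => (hasDerivAt_arctan x).hasDerivWithinAt) arctan_injective.injOn g
  rw [image_arctan_Ioo] at h
  rw [intervalIntegrable_iff_integrableOn_Ioo_of_le zero_le_one,
    intervalIntegrable_iff_integrableOn_Ioo_of_le (by positivity), h]
  refine integrableOn_congr_fun (fun x _ => ?_) measurableSet_Ioo
  simp only [smul_eq_mul]
  rw [abs_of_pos (by positivity)]; ring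

/-- The duplication `sin 2θ` on `[0, π / 4]`, in the variable `x = tan θ`. -/
theorem integral_comp_two_mul_div_one_add_sq {g : ℝ → ℝ}
    (h1 : IntervalIntegrable (fun x => g (x / √(1 + x ^ 2)) / (1 + x ^ 2)) volume 0 1)
    (h2 : IntervalIntegrable (fun x => g (1 / √(1 + x ^ 2)) / (1 + x ^ 2)) volume 0 1) :
    ∫ x in (0 : ℝ)..1, g (2 * x / (1 + x ^ 2)) / (1 + x ^ 2) =
      ((∫ x in (0 : ℝ)..1, g (x / √(1 + x ^ 2)) / (1 + x ^ 2)) +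
        ∫ x in (0 : ℝ)..1, g (1 / √(1 + x ^ 2)) / (1 + x ^ 2)) / 2 := by
  have e : ∀ x : ℝ, 2 * x / (1 + x ^ 2) = sin (2 * arctan x) := fun x => by
    rw [sin_two_mul, sin_arctan, cos_arctan]
    have h : √(1 + x ^ 2) ^ 2 = 1 + x ^ 2 := sq_sqrt (by positivity)
    have h' : √(1 + x ^ 2) ≠ 0 := by positivity
    have h'' : 1 + x ^ 2 ≠ 0 := by positivity
    field_simp
    rw [h]
  simp_rw [e, ← sin_arctan, ← cos_arctan] at h1 h2 ⊢
  rw [integral_comp_arctan fun θ => g (sin (2 * θ)), integral_comp_arctan fun θ => g (sin θ),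
    integral_comp_arctan fun θ => g (cos θ)]
  rw [← intervalIntegrable_iff_comp_arctan fun θ => g (sin θ)] at h1
  rw [← intervalIntegrable_iff_comp_arctan fun θ => g (cos θ)] at h2
  have e1 : ∀ θ, g (cos (π / 2 - θ)) = g (sin θ) := fun θ => by rw [cos_pi_div_two_sub]
  have h3 : IntervalIntegrable (fun θ => g (sin θ)) volume (π / 4) (π / 2) := by
    have := (h2.comp_sub_left (π / 2)).symm
    simp_rw [e1] at this
    convert! this using 1 <;> ring
  -- Reflection θ ↦ π/2 - θ moves the cosine integral to [π/4, π/2]. The two integrals join into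
  -- that of g(sin θ) over [0, π/2], which is twice the integral of g(sin 2θ) over [0, π/4].
  have h4 : ∫ θ in (0 : ℝ)..(π / 4), g (cos θ) = ∫ θ in (π / 4)..(π / 2), g (sin θ) := by
    have := intervalIntegral.integral_comp_sub_left (a := π / 4) (b := π / 2)
      (fun θ => g (cos θ)) (π / 2)
    simp_rw [e1] at this
    rw [this]; congr 1 <;> ring
  have h5 := intervalIntegral.integral_comp_mul_left (a := 0) (b := π / 4)
    (fun θ => g (sin θ)) (c := 2) two_ne_zero
  rw [h5, h4, intervalIntegral.integral_add_adjacent_intervals h1 h3, smul_eq_mul]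
  rw [mul_zero, show 2 * (π / 4) = π / 2 by ring]
  ring

/-! ### Logarithmic integrals over 1 + x² from duplication -/

theorem continuous_log_one_add_sq : Continuous fun x : ℝ => log (1 + x ^ 2) :=
  Continuous.log (by fun_prop) fun x => by positivity

theorem intervalIntegrable_div_one_add_sq {f : ℝ → ℝ} (hf : IntervalIntegrable f volume 0 1) :
    IntervalIntegrable (fun x => f x / (1 + x ^ 2)) volume 0 1 :=
  hf.mul_continuousOn continuous_one_add_sq_inv.continuousOn

theorem log_one_div_sqrt (x : ℝ) : log (1 / √(1 + x ^ 2)) = -(log (1 + x ^ 2) / 2) := by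
  rw [one_div, log_inv, log_sqrt (by positivity)]

theorem log_div_sqrt {x : ℝ} (hx : 0 < x) :
    log (x / √(1 + x ^ 2)) = log x - log (1 + x ^ 2) / 2 := by
  rw [log_div hx.ne' (by positivity), log_sqrt (by positivity)]

theorem log_two_mul_div {x : ℝ} (hx : 0 < x) :
    log (2 * x / (1 + x ^ 2)) = log 2 + log x - log (1 + x ^ 2) := by
  rw [log_div (by positivity) (by positivity), log_mul two_ne_zero hx.ne']

theorem integral_congr_zero_one {f g : ℝ → ℝ} (h : ∀ x, 0 < x → x < 1 → f x = g x) :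
    ∫ x in (0 : ℝ)..1, f x = ∫ x in (0 : ℝ)..1, g x := by
  rw [integral_of_le zero_le_one, integral_of_le zero_le_one, integral_Ioc_eq_integral_Ioo,
    integral_Ioc_eq_integral_Ioo]
  exact setIntegral_congr_fun measurableSet_Ioo fun x hx => h x hx.1 hx.2

theorem intervalIntegrable_congr_zero_one {f g : ℝ → ℝ} (h : ∀ x, 0 < x → x < 1 → f x = g x)
    (hg : IntervalIntegrable g volume 0 1) : IntervalIntegrable f volume 0 1 := by
  rw [intervalIntegrable_iff_integrableOn_Ioo_of_le zero_le_one] at hg ⊢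
  exact hg.congr_fun (fun x hx => (h x hx.1 hx.2).symm) measurableSet_Ioo

theorem integral_one_div_one_add_sq_zero_one : ∫ x in (0 : ℝ)..1, 1 / (1 + x ^ 2) = π / 4 := by
  simp

/-- Duplication with g = log is a linear equation in this integral: with L its value, (π/4) log 2 -
G - L = -(G + L)/2. -/
theorem integral_log_one_add_sq_div_one_add_sq :
    ∫ x in (0 : ℝ)..1, log (1 + x ^ 2) / (1 + x ^ 2) = π * log 2 / 2 - ArctanSums.catalan := by
  have ia : IntervalIntegrable (fun x : ℝ => log x / (1 + x ^ 2)) volume 0 1 :=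
    intervalIntegrable_div_one_add_sq intervalIntegrable_log'
  have id : IntervalIntegrable (fun x : ℝ => log (1 + x ^ 2) / (1 + x ^ 2)) volume 0 1 :=
    intervalIntegrable_div_one_add_sq (continuous_log_one_add_sq.intervalIntegrable _ _)
  have i1 : IntervalIntegrable (fun x : ℝ => 1 / (1 + x ^ 2)) volume 0 1 :=
    intervalIntegrable_div_one_add_sq (continuous_const.intervalIntegrable _ _)
  have c1 : ∀ x : ℝ, 0 < x → x < 1 → log (x / √(1 + x ^ 2)) / (1 + x ^ 2)
      = log x / (1 + x ^ 2) - (1 / 2) * (log (1 + x ^ 2) / (1 + x ^ 2)) := fun x hx _ => by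
    rw [log_div_sqrt hx]; ring
  have c2 : ∀ x : ℝ, 0 < x → x < 1 → log (1 / √(1 + x ^ 2)) / (1 + x ^ 2)
      = -(1 / 2) * (log (1 + x ^ 2) / (1 + x ^ 2)) := fun x hx _ => by
    rw [log_one_div_sqrt]; ring
  have c3 : ∀ x : ℝ, 0 < x → x < 1 → log (2 * x / (1 + x ^ 2)) / (1 + x ^ 2)
      = log 2 * (1 / (1 + x ^ 2)) + log x / (1 + x ^ 2) - log (1 + x ^ 2) / (1 + x ^ 2) :=
    fun x hx _ => by rw [log_two_mul_div hx]; ring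
  have h := integral_comp_two_mul_div_one_add_sq (g := log)
    (intervalIntegrable_congr_zero_one c1 (ia.sub (id.const_mul _)))
    (intervalIntegrable_congr_zero_one c2 (id.const_mul _))
  rw [integral_congr_zero_one c1, integral_congr_zero_one c2, integral_congr_zero_one c3,
    intervalIntegral.integral_sub ((i1.const_mul _).add ia) id,
    intervalIntegral.integral_add (i1.const_mul _) ia, intervalIntegral.integral_const_mul,
    intervalIntegral.integral_sub ia (id.const_mul _), intervalIntegral.integral_const_mul,
    intervalIntegral.integral_const_mul, integral_one_div_one_add_sq_zero_one,
    integral_log_div_one_add_sq] at h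
  linarith

/-- Duplication with g = log² relates the mixed integral to that of log²(1+x²). It gives one
equation for two unknowns; the second unknown needs the trilogarithm. -/
theorem integral_log_mul_log_one_add_sq_div_one_add_sq :
    ∫ x in (0 : ℝ)..1, log x * log (1 + x ^ 2) / (1 + x ^ 2) =
      -(π * log 2 ^ 2) / 2 + π ^ 3 / 48 +
        (∫ x in (0 : ℝ)..1, log (1 + x ^ 2) ^ 2 / (1 + x ^ 2)) / 2 := by
  have ia : IntervalIntegrable (fun x : ℝ => log x / (1 + x ^ 2)) volume 0 1 :=
    intervalIntegrable_div_one_add_sq intervalIntegrable_log'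
  have id : IntervalIntegrable (fun x : ℝ => log (1 + x ^ 2) / (1 + x ^ 2)) volume 0 1 :=
    intervalIntegrable_div_one_add_sq (continuous_log_one_add_sq.intervalIntegrable _ _)
  have i1 : IntervalIntegrable (fun x : ℝ => 1 / (1 + x ^ 2)) volume 0 1 :=
    intervalIntegrable_div_one_add_sq (continuous_const.intervalIntegrable _ _)
  have iaa : IntervalIntegrable (fun x : ℝ => log x ^ 2 / (1 + x ^ 2)) volume 0 1 :=
    intervalIntegrable_div_one_add_sq intervalIntegrable_log_sq
  have idd : IntervalIntegrable (fun x : ℝ => log (1 + x ^ 2) ^ 2 / (1 + x ^ 2)) volume 0 1 :=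
    intervalIntegrable_div_one_add_sq ((continuous_log_one_add_sq.pow 2).intervalIntegrable _ _)
  have iad : IntervalIntegrable (fun x : ℝ => log x * log (1 + x ^ 2) / (1 + x ^ 2)) volume 0 1 :=
    intervalIntegrable_div_one_add_sq
      (intervalIntegrable_log'.mul_continuousOn continuous_log_one_add_sq.continuousOn)
  have c1 : ∀ x : ℝ, 0 < x → x < 1 → log (x / √(1 + x ^ 2)) ^ 2 / (1 + x ^ 2)
      = log x ^ 2 / (1 + x ^ 2) + -1 * (log x * log (1 + x ^ 2) / (1 + x ^ 2))
        + 1 / 4 * (log (1 + x ^ 2) ^ 2 / (1 + x ^ 2)) := fun x hx _ => by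
    rw [log_div_sqrt hx]; ring
  have c2 : ∀ x : ℝ, 0 < x → x < 1 → log (1 / √(1 + x ^ 2)) ^ 2 / (1 + x ^ 2)
      = 1 / 4 * (log (1 + x ^ 2) ^ 2 / (1 + x ^ 2)) := fun x hx _ => by
    rw [log_one_div_sqrt]; ring
  have c3 : ∀ x : ℝ, 0 < x → x < 1 → log (2 * x / (1 + x ^ 2)) ^ 2 / (1 + x ^ 2)
      = log 2 ^ 2 * (1 / (1 + x ^ 2)) + log x ^ 2 / (1 + x ^ 2)
        + log (1 + x ^ 2) ^ 2 / (1 + x ^ 2) + 2 * log 2 * (log x / (1 + x ^ 2))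
        + -(2 * log 2) * (log (1 + x ^ 2) / (1 + x ^ 2))
        + -2 * (log x * log (1 + x ^ 2) / (1 + x ^ 2)) :=
    fun x hx _ => by rw [log_two_mul_div hx]; ring
  have h := integral_comp_two_mul_div_one_add_sq (g := fun y => log y ^ 2)
    (intervalIntegrable_congr_zero_one c1 ((iaa.add (iad.const_mul _)).add (idd.const_mul _)))
    (intervalIntegrable_congr_zero_one c2 (idd.const_mul _))
  rw [integral_congr_zero_one c1, integral_congr_zero_one c2, integral_congr_zero_one c3,
    intervalIntegral.integral_add (((((i1.const_mul _).add iaa).add idd).add (ia.const_mul _)).add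
      (id.const_mul _)) (iad.const_mul _),
    intervalIntegral.integral_add ((((i1.const_mul _).add iaa).add idd).add (ia.const_mul _))
      (id.const_mul _),
    intervalIntegral.integral_add (((i1.const_mul _).add iaa).add idd) (ia.const_mul _),
    intervalIntegral.integral_add ((i1.const_mul _).add iaa) idd,
    intervalIntegral.integral_add (i1.const_mul _) iaa,
    intervalIntegral.integral_add (iaa.add (iad.const_mul _)) (idd.const_mul _),
    intervalIntegral.integral_add iaa (iad.const_mul _)] at h
  simp only [intervalIntegral.integral_const_mul] at h
  rw [integral_one_div_one_add_sq_zero_one, integral_log_div_one_add_sq,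
    integral_log_sq_div_one_add_sq, integral_log_one_add_sq_div_one_add_sq] at h
  linarith

theorem hasDerivAt_log_one_add_sq (x : ℝ) :
    HasDerivAt (fun x : ℝ => log (1 + x ^ 2)) (2 * x / (1 + x ^ 2)) x := by
  refine (((hasDerivAt_pow 2 x).const_add 1).log (by positivity)).congr_deriv ?_
  push_cast; simp

/-- By parts: log(1+x²) · arctan x has boundary value (π/4) log 2, and the other half of its
derivative is the integral of log(1+x²)/(1+x²). -/
theorem integral_mul_arctan_div_one_add_sq :
    ∫ x in (0 : ℝ)..1, x / (1 + x ^ 2) * arctan x =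
      ArctanSums.catalan / 2 - π * log 2 / 8 := by
  have hc : Continuous fun x : ℝ => x / (1 + x ^ 2) := by
    simpa using continuous_pow_div_one_add_sq 1
  have ct : Continuous arctan := continuous_arctan
  have i1 : IntervalIntegrable (fun x : ℝ => 2 * (x / (1 + x ^ 2) * arctan x)) volume 0 1 :=
    ((hc.mul ct).const_mul 2).intervalIntegrable _ _
  have i2 : IntervalIntegrable (fun x : ℝ => log (1 + x ^ 2) / (1 + x ^ 2)) volume 0 1 :=
    intervalIntegrable_div_one_add_sq (continuous_log_one_add_sq.intervalIntegrable _ _)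
  have h := integral_eq_sub_of_hasDerivAt (a := 0) (b := 1)
    (f := fun x => log (1 + x ^ 2) * arctan x)
    (f' := fun x => 2 * (x / (1 + x ^ 2) * arctan x) + log (1 + x ^ 2) / (1 + x ^ 2))
    (fun x _ => by
      refine ((hasDerivAt_log_one_add_sq x).fun_mul (hasDerivAt_arctan x)).congr_deriv ?_
      ring) (i1.add i2)
  rw [intervalIntegral.integral_add i1 i2, intervalIntegral.integral_const_mul,
    integral_log_one_add_sq_div_one_add_sq] at h
  norm_num at h
  linarith

theorem arctan_le_self_of_nonneg {x : ℝ} (hx : 0 ≤ x) : arctan x ≤ x := by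
  have h := le_tan (arctan_nonneg.2 hx) (arctan_lt_pi_div_two x)
  rwa [tan_arctan] at h

theorem tendsto_log_mul_arctan_zero :
    Tendsto (fun x => log x * arctan x) (𝓝[>] 0) (𝓝 0) := by
  have h : Tendsto (fun x : ℝ => |x * log x|) (𝓝[>] 0) (𝓝 0) := by
    have := (continuous_mul_log.abs.tendsto 0).mono_left (nhdsWithin_le_nhds (s := Ioi 0))
    simpa using this
  refine squeeze_zero_norm' ?_ h
  filter_upwards [self_mem_nhdsWithin] with x hx
  have hx' : (0 : ℝ) < x := hx
  rw [Real.norm_eq_abs, abs_mul, abs_mul, mul_comm]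
  refine mul_le_mul_of_nonneg_right ?_ (abs_nonneg _)
  rw [abs_of_nonneg (arctan_nonneg.2 hx'.le), abs_of_pos hx']
  exact arctan_le_self_of_nonneg hx'.le

/-! ### Polylogarithms -/

theorem summable_one_div_succ_pow {s : ℕ} (hs : 2 ≤ s) :
    Summable fun n : ℕ => 1 / ((n : ℝ) + 1) ^ s := by
  have := (summable_nat_add_iff 1).2 (Real.summable_one_div_nat_pow.2 (show 1 < s by omega))
  simpa using this

theorem norm_natCast_add_one_pow (n s : ℕ) : ‖((n : ℂ) + 1) ^ s‖ = ((n : ℝ) + 1) ^ s := by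
  rw [norm_pow]
  congr 1
  have : ((n : ℂ) + 1) = ((n + 1 : ℕ) : ℂ) := by push_cast; ring
  rw [this, Complex.norm_natCast]; push_cast; ring

/-- Weierstrass M-test. The closed disc matters: the value at the boundary point 1 is used below as
a limit. -/
theorem continuousOn_polylog {s : ℕ} (hs : 2 ≤ s) :
    ContinuousOn (ArctanSums.polylog s) (Metric.closedBall 0 1) := by
  refine continuousOn_tsum (u := fun n : ℕ => 1 / ((n : ℝ) + 1) ^ s) (fun n => by fun_prop)
    (summable_one_div_succ_pow hs) fun n z hz => ?_
  rw [mem_closedBall_zero_iff] at hz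
  rw [norm_div, norm_natCast_add_one_pow, norm_pow]
  exact div_le_div_of_nonneg_right (pow_le_one₀ (norm_nonneg _) hz) (by positivity)

theorem hasDerivAt_polylog_succ (s : ℕ) {z : ℂ} (hz : ‖z‖ < 1) (hz0 : z ≠ 0) :
    HasDerivAt (ArctanSums.polylog (s + 1)) (ArctanSums.polylog s z / z) z := by
  -- On a disc of radius r with ‖z‖ < r < 1 the differentiated terms are dominated by r^n.
  obtain ⟨r, hzr, hr1⟩ := exists_between hz
  have hr0 : 0 ≤ r := (norm_nonneg z).trans hzr.le
  have hz' : z ∈ Metric.ball (0 : ℂ) r := by simpa using hzr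
  have hc : ∀ n : ℕ, ((n : ℂ) + 1) ≠ 0 := fun n => Nat.cast_add_one_ne_zero n
  have h := hasDerivAt_tsum_of_isPreconnected (t := Metric.ball (0 : ℂ) r)
    (g := fun (n : ℕ) (z : ℂ) => z ^ (n + 1) / ((n : ℂ) + 1) ^ (s + 1))
    (g' := fun (n : ℕ) (z : ℂ) => z ^ n / ((n : ℂ) + 1) ^ s)
    (u := fun n => r ^ n) (summable_geometric_of_lt_one hr0 hr1) Metric.isOpen_ball
    (convex_ball _ _).isPreconnected
    (fun n y _ => by
      refine ((hasDerivAt_pow (n + 1) y).div_const _).congr_deriv ?_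
      have := hc n
      push_cast
      field_simp
      ring)
    (fun n y hy => by
      rw [mem_ball_zero_iff] at hy
      rw [norm_div, norm_natCast_add_one_pow, norm_pow]
      have h1 : (1 : ℝ) ≤ ((n : ℝ) + 1) ^ s := one_le_pow₀ (by linarith [n.cast_nonneg (α := ℝ)])
      calc ‖y‖ ^ n / ((n : ℝ) + 1) ^ s ≤ ‖y‖ ^ n := div_le_self (by positivity) h1
        _ ≤ r ^ n := pow_le_pow_left₀ (norm_nonneg _) hy.le n)
    (y₀ := 0) (by simpa using (norm_nonneg z).trans_lt hzr) (by simp) hz'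
  refine h.congr_deriv ?_
  rw [ArctanSums.polylog, ← tsum_div_const]
  refine tsum_congr fun n => ?_
  rw [pow_succ]
  field_simp

theorem polylog_one {z : ℂ} (hz : ‖z‖ < 1) : ArctanSums.polylog 1 z = -Complex.log (1 - z) := by
  have h := (hasSum_nat_add_iff' 1).2 (Complex.hasSum_taylorSeries_neg_log hz)
  simp at h
  rw [ArctanSums.polylog, ← h.tsum_eq]
  simp

theorem hasDerivAt_polylog_two {z : ℂ} (hz : ‖z‖ < 1) (hz0 : z ≠ 0) :
    HasDerivAt (ArctanSums.polylog 2) (-Complex.log (1 - z) / z) z := by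
  rw [← polylog_one hz]; exact hasDerivAt_polylog_succ 1 hz hz0

theorem polylog_ofReal_im (s : ℕ) (x : ℝ) : (ArctanSums.polylog s x).im = 0 := by
  have : ArctanSums.polylog s x = ((∑' n : ℕ, x ^ (n + 1) / ((n : ℝ) + 1) ^ s : ℝ) : ℂ) := by
    rw [ArctanSums.polylog, Complex.ofReal_tsum]; push_cast; rfl
  rw [this, Complex.ofReal_im]

theorem polylog_two_one : ArctanSums.polylog 2 1 = ((π ^ 2 / 6 : ℝ) : ℂ) := by
  have hz : HasSum (fun m : ℕ => 1 / ((m : ℝ) + 1) ^ 2) (π ^ 2 / 6) := by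
    have := (hasSum_nat_add_iff' 1).2 hasSum_zeta_two
    simpa using this
  have h := (Complex.hasSum_ofReal.2 hz).tsum_eq
  rw [← h, ArctanSums.polylog]
  simp

theorem polylog_zero_right {s : ℕ} : ArctanSums.polylog s 0 = 0 := by
  simp [ArctanSums.polylog]

/-- Euler's reflection formula: Li₂(x) + Li₂(1-x) + log x log(1-x) has zero derivative. Its limit at
0 is Li₂(1) = π²/6 and its value at 1/2 is 2 Li₂(1/2) + log²2. -/
theorem polylog_two_one_half :
    ArctanSums.polylog 2 (1 / 2) = ((π ^ 2 / 12 - log 2 ^ 2 / 2 : ℝ) : ℂ) := by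
  set f : ℝ → ℂ := fun x => ArctanSums.polylog 2 x + ArctanSums.polylog 2 (1 - x)
    + ((log x * log (1 - x) : ℝ) : ℂ) with hf
  have hlog : ∀ x : ℝ, 0 < x → Complex.log x = (log x : ℂ) := fun x hx =>
    (Complex.ofReal_log hx.le).symm
  have hd : ∀ x ∈ Ioo (0 : ℝ) (1 / 2), HasDerivAt f 0 x := by
    intro x hx
    have hx0 : (x : ℂ) ≠ 0 := by exact_mod_cast hx.1.ne'
    have hx1' : 0 < 1 - x := by linarith [hx.2]
    have hx1 : (1 - x : ℂ) ≠ 0 := by exact_mod_cast hx1'.ne'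
    have n1 : ‖(x : ℂ)‖ < 1 := by
      rw [Complex.norm_real, Real.norm_eq_abs, abs_of_pos hx.1]; linarith [hx.2]
    have n2 : ‖(1 - x : ℂ)‖ < 1 := by
      rw [show (1 - x : ℂ) = ((1 - x : ℝ) : ℂ) by push_cast; rfl, Complex.norm_real,
        Real.norm_eq_abs, abs_of_pos hx1']; linarith [hx.1]
    have d1 : HasDerivAt (fun x : ℝ => ArctanSums.polylog 2 x) _ x :=
      (hasDerivAt_polylog_two n1 hx0).comp_ofReal
    have d2 : HasDerivAt (fun x : ℝ => ArctanSums.polylog 2 (1 - x)) _ x :=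
      ((hasDerivAt_polylog_two n2 hx1).comp (x : ℂ)
        ((hasDerivAt_id (x : ℂ)).const_sub 1)).comp_ofReal
    have d3 : HasDerivAt (fun x : ℝ => ((log x * log (1 - x) : ℝ) : ℂ)) _ x :=
      ((hasDerivAt_log hx.1.ne').fun_mul
        (((hasDerivAt_id x).const_sub 1).log hx1'.ne')).ofReal_comp
    refine ((d1.fun_add d2).fun_add d3).congr_deriv ?_
    rw [sub_sub_cancel, hlog x hx.1, show (1 - x : ℂ) = ((1 - x : ℝ) : ℂ) by push_cast; rfl,
      hlog _ hx1']
    have hx1r := hx1'.ne'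
    have hx0r := hx.1.ne'
    push_cast
    simp only [id]
    field_simp
    ring
  have hc := continuousOn_polylog (le_refl 2)
  have t0 : Tendsto f (𝓝[>] 0) (𝓝 (0 + ArctanSums.polylog 2 1 + 0)) := by
    refine (Tendsto.add ?_ ?_).add ?_
    · have : ContinuousAt (ArctanSums.polylog 2) ((0 : ℝ) : ℂ) :=
        hc.continuousAt (Metric.closedBall_mem_nhds_of_mem (by simp))
      have h2 : Tendsto (fun x : ℝ => ArctanSums.polylog 2 x) (𝓝 0)
          (𝓝 (ArctanSums.polylog 2 ((0 : ℝ) : ℂ))) :=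
        this.tendsto.comp (Complex.continuous_ofReal.tendsto 0)
      rw [Complex.ofReal_zero, polylog_zero_right] at h2
      exact h2.mono_left nhdsWithin_le_nhds
    · have h1 : ContinuousWithinAt (ArctanSums.polylog 2) (Metric.closedBall 0 1) (1 : ℂ) :=
        hc 1 (by simp)
      refine h1.tendsto.comp (tendsto_nhdsWithin_iff.2 ⟨?_, ?_⟩)
      · have : Tendsto (fun x : ℝ => (1 - x : ℂ)) (𝓝 0) (𝓝 (1 - (0 : ℝ))) :=
          (Continuous.tendsto (by fun_prop) 0)
        simp at this
        exact this.mono_left nhdsWithin_le_nhds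
      · filter_upwards [Ioo_mem_nhdsGT (show (0 : ℝ) < 1 by norm_num)] with x hx
        rw [mem_closedBall_zero_iff, show (1 - x : ℂ) = ((1 - x : ℝ) : ℂ) by push_cast; rfl,
          Complex.norm_real, Real.norm_eq_abs, abs_of_pos (by linarith [hx.2])]
        linarith [hx.1]
    · rw [← Complex.ofReal_zero]
      refine (Complex.continuous_ofReal.tendsto 0).comp ?_
      have h : Tendsto (fun x : ℝ => 2 * |x * log x|) (𝓝[>] 0) (𝓝 0) := by
        have := ((continuous_mul_log.abs.const_mul 2).tendsto 0).mono_left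
          (nhdsWithin_le_nhds (s := Ioi 0))
        simpa using this
      refine squeeze_zero_norm' ?_ h
      filter_upwards [Ioo_mem_nhdsGT (show (0 : ℝ) < 1 / 2 by norm_num)] with x hx
      have hx1' : 0 < 1 - x := by linarith [hx.2]
      have h1 : log (1 - x) ≤ 0 := log_nonpos hx1'.le (by linarith [hx.1])
      have h2 : -log (1 - x) ≤ 2 * x := by
        rw [← log_inv]
        have h3 := log_le_sub_one_of_pos (inv_pos.2 hx1')
        have h4 : (1 - x)⁻¹ - 1 ≤ 2 * x := by
          rw [sub_le_iff_le_add, inv_le_iff_one_le_mul₀ hx1']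
          nlinarith [hx.1, hx.2]
        linarith
      rw [Real.norm_eq_abs, abs_mul, abs_mul, abs_of_nonpos h1, abs_of_pos hx.1, ← mul_assoc,
        mul_comm]
      exact mul_le_mul_of_nonneg_right h2 (abs_nonneg _)
  have t1 : Tendsto f (𝓝[<] (1 / 2)) (𝓝 (f (1 / 2))) := by
    have : ContinuousAt f (1 / 2) := by
      have hb : ContinuousAt (ArctanSums.polylog 2) ((1 / 2 : ℝ) : ℂ) :=
        hc.continuousAt (Metric.closedBall_mem_nhds_of_mem (by
          rw [mem_ball_zero_iff, Complex.norm_real]; norm_num))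
      have hb' : ContinuousAt (ArctanSums.polylog 2) (1 - ((1 / 2 : ℝ) : ℂ)) := by
        convert! hb using 1; push_cast; norm_num
      refine (ContinuousAt.add ?_ ?_).add ?_
      · exact hb.comp Complex.continuous_ofReal.continuousAt
      · exact ContinuousAt.comp (f := fun x : ℝ => (1 - x : ℂ)) hb' (by fun_prop)
      · refine Complex.continuous_ofReal.continuousAt.comp ?_
        exact (continuousAt_log (by norm_num)).mul
          (ContinuousAt.log (by fun_prop) (by norm_num))
    exact this.tendsto.mono_left nhdsWithin_le_nhds
  have h := integral_eq_sub_of_hasDerivAt_of_tendsto (by norm_num) hd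
    (continuous_const.intervalIntegrable _ _) t0 t1
  rw [intervalIntegral.integral_zero, polylog_two_one] at h
  simp only [hf] at h
  have e1 : log (1 - 1 / 2) = -log 2 := by rw [← log_inv]; norm_num
  have e2 : log (1 / 2) = -log 2 := by rw [← log_inv]; norm_num
  rw [e1, e2] at h
  have e3 : (1 - ((1 / 2 : ℝ) : ℂ)) = 1 / 2 := by push_cast; norm_num
  rw [e3] at h
  push_cast at h ⊢
  linear_combination -h / 2

/-! ### Trilogarithm antiderivatives and W(3) -/

/-- `log (1 + i x)` for real `x`, in terms of real functions. -/
noncomputable def logOneAddMulI (x : ℝ) : ℂ :=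
  ((log (1 + x ^ 2) / 2 : ℝ) : ℂ) + ((arctan x : ℝ) : ℂ) * Complex.I

theorem one_add_mul_I_ne_zero (x : ℝ) : (1 + x * Complex.I : ℂ) ≠ 0 := by
  intro h
  have := congrArg Complex.re h
  simp at this

theorem one_sub_mul_I_ne_zero (x : ℝ) : (1 - x * Complex.I : ℂ) ≠ 0 := by
  intro h
  have := congrArg Complex.re h
  simp at this

theorem one_add_mul_I_mul_one_sub_mul_I (x : ℝ) :
    (1 + x * Complex.I : ℂ) * (1 - x * Complex.I) = ((1 + x ^ 2 : ℝ) : ℂ) := by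
  push_cast
  linear_combination (-(x : ℂ) ^ 2) * Complex.I_sq

theorem logOneAddMulI_im (x : ℝ) : (logOneAddMulI x).im = arctan x := by
  simp only [logOneAddMulI, Complex.add_im, Complex.mul_im, Complex.ofReal_re, Complex.ofReal_im,
    Complex.I_re, Complex.I_im]
  ring

theorem exp_logOneAddMulI (x : ℝ) : Complex.exp (logOneAddMulI x) = 1 + x * Complex.I := by
  rw [logOneAddMulI, Complex.exp_add, Complex.exp_mul_I, ← Complex.ofReal_exp,
    ← Complex.ofReal_cos, ← Complex.ofReal_sin, ← log_sqrt (by positivity),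
    exp_log (by positivity), cos_arctan, sin_arctan]
  have h : √(1 + x ^ 2) ≠ 0 := by positivity
  have h' : ((√(1 + x ^ 2) : ℝ) : ℂ) ≠ 0 := by exact_mod_cast h
  push_cast
  field_simp

theorem hasDerivAt_logOneAddMulI (x : ℝ) :
    HasDerivAt logOneAddMulI (Complex.I / (1 + x * Complex.I)) x := by
  have h1 := ((hasDerivAt_log_one_add_sq x).div_const 2).ofReal_comp
  have h2 := (hasDerivAt_arctan x).ofReal_comp.mul_const Complex.I
  refine (h1.fun_add h2).congr_deriv ?_
  have e := one_add_mul_I_mul_one_sub_mul_I x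
  have n1 := one_add_mul_I_ne_zero x
  have n3 : ((1 + x ^ 2 : ℝ) : ℂ) ≠ 0 := by exact_mod_cast (by positivity : (1 + x ^ 2 : ℝ) ≠ 0)
  push_cast at e n3 ⊢
  field_simp
  linear_combination x * Complex.I_sq

theorem hasDerivAt_logOneAddMulI_neg (x : ℝ) :
    HasDerivAt (fun x => logOneAddMulI (-x)) (-Complex.I / (1 - x * Complex.I)) x := by
  have h := (hasDerivAt_logOneAddMulI (-x)).scomp x (hasDerivAt_neg x)
  refine h.congr_deriv ?_
  simp [sub_eq_add_neg, neg_div]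

/-- Fixes the branch: a logarithm with imaginary part in (-π, π] is the principal one. -/
theorem log_eq_of_exp_eq {w z : ℂ} (h : Complex.exp w = z) (h1 : -π < w.im) (h2 : w.im ≤ π) :
    Complex.log z = w := by
  rw [← h, Complex.log_exp h1 h2]

theorem norm_one_add_mul_I_sq (x : ℝ) : ‖(1 + x * Complex.I : ℂ)‖ ^ 2 = 1 + x ^ 2 := by
  rw [← Complex.normSq_eq_norm_sq, Complex.normSq_apply]
  simp; ring

theorem norm_one_sub_mul_I_sq (x : ℝ) : ‖(1 - x * Complex.I : ℂ)‖ ^ 2 = 1 + x ^ 2 := by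
  rw [← Complex.normSq_eq_norm_sq, Complex.normSq_apply]
  simp; ring

theorem logOneAddMulI_neg_one :
    logOneAddMulI (-1) = ((log 2 / 2 : ℝ) : ℂ) - ((π / 4 : ℝ) : ℂ) * Complex.I := by
  rw [logOneAddMulI, arctan_neg, arctan_one]; norm_num [sub_eq_add_neg]

theorem logOneAddMulI_one :
    logOneAddMulI 1 = ((log 2 / 2 : ℝ) : ℂ) + ((π / 4 : ℝ) : ℂ) * Complex.I := by
  rw [logOneAddMulI, arctan_one]; norm_num

theorem logOneAddMulI_zero : logOneAddMulI 0 = 0 := by simp [logOneAddMulI]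

theorem HasDerivAt.complex_im {f : ℝ → ℂ} {f' : ℂ} {x : ℝ} (h : HasDerivAt f f' x) :
    HasDerivAt (fun x => (f x).im) f'.im x :=
  Complex.imCLM.hasFDerivAt.comp_hasDerivAt x h

theorem log_one_sub_half (x : ℝ) :
    Complex.log (1 - (1 + x * Complex.I) / 2) = logOneAddMulI (-x) - (log 2 : ℝ) := by
  apply log_eq_of_exp_eq
  · rw [Complex.exp_sub, exp_logOneAddMulI, ← Complex.ofReal_exp, exp_log two_pos]
    push_cast; ring
  · rw [Complex.sub_im, Complex.ofReal_im, logOneAddMulI_im]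
    linarith [neg_pi_div_two_lt_arctan (-x), arctan_neg x, pi_pos]
  · rw [Complex.sub_im, Complex.ofReal_im, logOneAddMulI_im]
    linarith [arctan_lt_pi_div_two (-x), arctan_neg x, pi_pos]

/-- Let Λ(x) = log((1+ix)/(1+i)) = a + ib, with a = (log(1+x²) - log 2)/2 and b = arctan x - π/4.
The integral of Λ² du/(1-u), u = (1+ix)/2, has a closed form in Li₂(u) and Li₃(u), and its imaginary
part contains a²/(1+x²). The shift by log 2 makes Λ vanish at x = 1, so that only Li₃((1+i)/2)
survives there. -/
theorem integral_log_one_add_sq_sub_sq :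
    ∫ x in (0 : ℝ)..1, (log (1 + x ^ 2) - log 2) ^ 2 / (1 + x ^ 2) =
      2 * (2 * ArctanSums.W3 - 7 * π ^ 3 / 192 + π * log 2 ^ 2 / 16) := by
  set l : ℂ := ((log 2 : ℝ) : ℂ) with hl
  -- The constant `e` is log(1-i), so `logOneAddMulI x - l + e` is Λ.
  set e : ℂ := ((log 2 / 2 : ℝ) : ℂ) - ((π / 4 : ℝ) : ℂ) * Complex.I with he
  set F : ℝ → ℂ := fun x =>
    -(logOneAddMulI (-x) - l) * (logOneAddMulI x - l + e) ^ 2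
      - 2 * (logOneAddMulI x - l + e) * ArctanSums.polylog 2 ((1 + x * Complex.I) / 2)
      + 2 * ArctanSums.polylog 3 ((1 + x * Complex.I) / 2) with hF
  have hdF : ∀ x ∈ Icc (0 : ℝ) 1, HasDerivAt F
      (Complex.I / (1 - x * Complex.I) * (logOneAddMulI x - l + e) ^ 2) x := by
    intro x hx
    have n1 := one_add_mul_I_ne_zero x
    have n2 := one_sub_mul_I_ne_zero x
    have ht : ‖((1 + x * Complex.I) / 2 : ℂ)‖ < 1 := by
      rw [norm_div, Complex.norm_ofNat, div_lt_one two_pos]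
      refine lt_of_pow_lt_pow_left₀ 2 two_pos.le ?_
      rw [norm_one_add_mul_I_sq]
      nlinarith [hx.1, hx.2]
    have ht0 : ((1 + x * Complex.I) / 2 : ℂ) ≠ 0 := div_ne_zero n1 two_ne_zero
    have hin : HasDerivAt (fun z : ℂ => (1 + z * Complex.I) / 2) (Complex.I / 2) (x : ℂ) := by
      simpa using (((hasDerivAt_id (x : ℂ)).mul_const Complex.I).const_add 1).div_const 2
    have d2 := ((hasDerivAt_polylog_two ht ht0).comp (x : ℂ) hin).comp_ofReal
    have d3 := ((hasDerivAt_polylog_succ 2 ht ht0).comp (x : ℂ) hin).comp_ofReal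
    have dp := hasDerivAt_logOneAddMulI x
    have dq := hasDerivAt_logOneAddMulI_neg x
    have key := (((dq.sub_const l).fun_neg.fun_mul (((dp.sub_const l).add_const e).fun_pow 2)).fun_sub
      ((((dp.sub_const l).add_const e).const_mul 2).fun_mul d2)).fun_add (d3.const_mul 2)
    refine key.congr_deriv ?_
    rw [log_one_sub_half]
    simp only [Function.comp]
    push_cast
    field_simp
    ring
  -- The imaginary part of the derivative of `F` is (a² - b² - 2xab)/(1+x²). Adding b³/3 and a²b to
  -- the antiderivative cancels the b² and xab terms and leaves 2a²/(1+x²).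
  set f : ℝ → ℝ := fun x => (F x).im + (arctan x - π / 4) ^ 3 / 3
    + 1 / 4 * (log (1 + x ^ 2) - log 2) ^ 2 * (arctan x - π / 4) with hf
  have hdf : ∀ x ∈ Icc (0 : ℝ) 1, HasDerivAt f
      (1 / 2 * ((log (1 + x ^ 2) - log 2) ^ 2 / (1 + x ^ 2))) x := by
    intro x hx
    have d1 := (hdF x hx).complex_im
    have da := (hasDerivAt_arctan x).sub_const (π / 4)
    have dd := (hasDerivAt_log_one_add_sq x).sub_const (log 2)
    refine ((d1.fun_add ((da.fun_pow 3).div_const 3)).fun_add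
      (((dd.fun_pow 2).const_mul (1 / 4)).fun_mul da)).congr_deriv ?_
    have e1 : Complex.I / (1 - x * Complex.I)
        = ((-x / (1 + x ^ 2) : ℝ) : ℂ) + ((1 / (1 + x ^ 2) : ℝ) : ℂ) * Complex.I := by
      have e := one_add_mul_I_mul_one_sub_mul_I x
      have n1 := one_sub_mul_I_ne_zero x
      have n3 : ((1 + x ^ 2 : ℝ) : ℂ) ≠ 0 := by
        exact_mod_cast (by positivity : (1 + x ^ 2 : ℝ) ≠ 0)
      push_cast at e n3 ⊢
      rw [div_eq_iff n1]
      field_simp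
      linear_combination x * Complex.I_sq
    have e2 : logOneAddMulI x - l + e = ((log (1 + x ^ 2) / 2 - log 2 / 2 : ℝ) : ℂ)
        + ((arctan x - π / 4 : ℝ) : ℂ) * Complex.I := by
      rw [logOneAddMulI, hl, he]; push_cast; ring
    rw [e1, e2]
    have hx2 : (1 + x ^ 2 : ℝ) ≠ 0 := by positivity
    simp only [pow_two, Complex.add_im, Complex.mul_im, Complex.add_re, Complex.mul_re,
      Complex.ofReal_re, Complex.ofReal_im, Complex.I_re, Complex.I_im]
    simp only [← pow_two]
    push_cast
    field_simp
    ring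
  have h := integral_eq_sub_of_hasDerivAt (a := 0) (b := 1) (f := f)
    (fun x hx => hdf x (by rwa [uIcc_of_le zero_le_one] at hx))
    (((intervalIntegrable_div_one_add_sq
      (((continuous_log_one_add_sq.sub continuous_const).pow 2).intervalIntegrable _ _))).const_mul _)
  rw [intervalIntegral.integral_const_mul] at h
  have f1 : f 1 = 2 * ArctanSums.W3 := by
    have z : logOneAddMulI 1 - l + e = 0 := by
      rw [logOneAddMulI_one, hl, he]; push_cast; ring
    simp only [hf, hF]
    rw [z, arctan_one]
    simp [ArctanSums.W3]
  -- At x = 0 the argument is 1/2: Li₃(1/2) is real and drops out, while Li₂(1/2) is multiplied by a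
  -- complex factor and enters through its known value.
  have f0 : f 0 = log 2 * (π * log 2 / 4) + π / 2 * (π ^ 2 / 12 - log 2 ^ 2 / 2)
      - π ^ 3 / 192 - π * log 2 ^ 2 / 16 := by
    have z3 : (ArctanSums.polylog 3 (1 / 2)).im = 0 := by
      simpa using polylog_ofReal_im 3 (1 / 2)
    have z : (F 0).im = log 2 * (π * log 2 / 4) + π / 2 * (π ^ 2 / 12 - log 2 ^ 2 / 2) := by
      have e3 : (0 - l + e : ℂ) = ((-(log 2) / 2 : ℝ) : ℂ) + ((-π / 4 : ℝ) : ℂ) * Complex.I := by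
        rw [hl, he]; push_cast; ring
      simp only [hF]
      rw [neg_zero, logOneAddMulI_zero, Complex.ofReal_zero, zero_mul, add_zero,
        polylog_two_one_half, e3, hl]
      simp only [pow_two, Complex.add_im, Complex.sub_im, Complex.mul_im, Complex.add_re,
        Complex.mul_re, Complex.sub_re, Complex.neg_re, Complex.neg_im, Complex.zero_re,
        Complex.zero_im, Complex.re_ofNat, Complex.im_ofNat,
        Complex.ofReal_re, Complex.ofReal_im, Complex.I_re, Complex.I_im, z3]
      ring
    simp only [hf]
    rw [z]
    simp
    ring
  rw [f1, f0] at h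
  linarith

theorem log_one_add_sq_nonneg (x : ℝ) : 0 ≤ log (1 + x ^ 2) :=
  log_nonneg (by linarith [sq_nonneg x])

theorem log_one_add_sq_le (x : ℝ) : log (1 + x ^ 2) ≤ x ^ 2 := by
  have := log_le_sub_one_of_pos (show 0 < 1 + x ^ 2 by positivity)
  linarith

theorem intervalIntegrable_of_abs_le {f : ℝ → ℝ} {C : ℝ} (hf : ContinuousOn f (Ioo 0 1))
    (hC : ∀ x ∈ Ioo (0 : ℝ) 1, |f x| ≤ C) : IntervalIntegrable f volume 0 1 := by
  rw [intervalIntegrable_iff_integrableOn_Ioo_of_le zero_le_one]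
  refine Integrable.of_bound (hf.aestronglyMeasurable measurableSet_Ioo) C ?_
  filter_upwards [ae_restrict_mem measurableSet_Ioo] with x hx using hC x hx

theorem intervalIntegrable_arctan_div :
    IntervalIntegrable (fun x : ℝ => arctan x / x) volume 0 1 := by
  refine intervalIntegrable_of_abs_le (C := 1)
    (continuous_arctan.continuousOn.div continuousOn_id fun x hx => hx.1.ne') fun x hx => ?_
  rw [abs_of_nonneg (div_nonneg (arctan_nonneg.2 hx.1.le) hx.1.le), div_le_one hx.1]
  exact arctan_le_self_of_nonneg hx.1.le

theorem intervalIntegrable_log_one_add_sq_div :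
    IntervalIntegrable (fun x : ℝ => log (1 + x ^ 2) / x) volume 0 1 := by
  refine intervalIntegrable_of_abs_le (C := 1)
    (continuous_log_one_add_sq.continuousOn.div continuousOn_id fun x hx => hx.1.ne') fun x hx => ?_
  rw [abs_of_nonneg (div_nonneg (log_one_add_sq_nonneg x) hx.1.le), div_le_one hx.1]
  refine (log_one_add_sq_le x).trans ?_
  nlinarith [hx.1, hx.2]

theorem intervalIntegrable_log_one_add_sq_mul_arctan_div :
    IntervalIntegrable (fun x : ℝ => log (1 + x ^ 2) * arctan x / x) volume 0 1 := by
  have := intervalIntegrable_arctan_div.continuousOn_mul continuous_log_one_add_sq.continuousOn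
  simpa only [mul_div_assoc] using this

theorem log_one_sub_inv {x : ℝ} (hx : 0 < x) :
    Complex.log (1 - (1 - x * Complex.I)⁻¹) =
      ((log x : ℝ) : ℂ) - ((π / 2 : ℝ) : ℂ) * Complex.I - logOneAddMulI (-x) := by
  have n2 := one_sub_mul_I_ne_zero x
  have him : (((log x : ℝ) : ℂ) - ((π / 2 : ℝ) : ℂ) * Complex.I - logOneAddMulI (-x)).im
      = arctan x - π / 2 := by
    rw [Complex.sub_im, Complex.sub_im, Complex.ofReal_im, logOneAddMulI_im, arctan_neg]
    simp only [Complex.mul_im, Complex.ofReal_re, Complex.ofReal_im, Complex.I_re, Complex.I_im]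
    ring
  apply log_eq_of_exp_eq
  · rw [Complex.exp_sub, Complex.exp_sub, exp_logOneAddMulI, ← Complex.ofReal_exp, exp_log hx]
    push_cast
    rw [Complex.exp_pi_div_two_mul_I]
    rw [show (1 + -(x : ℂ) * Complex.I) = 1 - x * Complex.I by ring, eq_comm]
    field_simp
    linear_combination -(x : ℂ) * Complex.I_sq
  · rw [him]; linarith [neg_pi_div_two_lt_arctan x, arctan_pos.2 hx, pi_pos]
  · rw [him]; linarith [arctan_lt_pi_div_two x, pi_pos]

theorem tendsto_ofReal_log_mul_logOneAddMulI_neg :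
    Tendsto (fun x : ℝ => ((log x : ℝ) : ℂ) * logOneAddMulI (-x)) (𝓝[>] 0) (𝓝 0) := by
  have h1 : Tendsto (fun x : ℝ => log x * log (1 + x ^ 2)) (𝓝[>] 0) (𝓝 0) := by
    have h : Tendsto (fun x : ℝ => |x * (x * log x)|) (𝓝[>] 0) (𝓝 0) := by
      have := ((continuous_id.mul continuous_mul_log).abs.tendsto 0).mono_left
        (nhdsWithin_le_nhds (s := Ioi 0))
      simpa using this
    refine squeeze_zero_norm (fun x => ?_) h
    rw [Real.norm_eq_abs, ← mul_assoc, mul_comm, abs_mul, abs_mul]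
    refine mul_le_mul_of_nonneg_right ?_ (abs_nonneg _)
    rw [abs_of_nonneg (log_one_add_sq_nonneg x), ← pow_two, abs_of_nonneg (sq_nonneg x)]
    exact log_one_add_sq_le x
  have h := ((Complex.continuous_ofReal.tendsto _).comp (h1.div_const 2)).sub
    (((Complex.continuous_ofReal.tendsto _).comp tendsto_log_mul_arctan_zero).mul_const Complex.I)
  simp only [zero_div, Complex.ofReal_zero, zero_mul, sub_zero] at h
  refine h.congr fun x => ?_
  simp only [Function.comp, logOneAddMulI, arctan_neg, even_two.neg_pow]
  push_cast
  ring

theorem continuous_logOneAddMulI : Continuous logOneAddMulI :=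
  continuous_iff_continuousAt.2 fun x => (hasDerivAt_logOneAddMulI x).continuousAt

/-- With q = log(1-ix), Im(q²) = -log(1+x²) arctan x, so the integral is the imaginary part of that
of -q²/x, which has an antiderivative in polylogarithms of u = 1/(1-ix). Subtracting 2eq from q², e
= log(1-i), makes the Li₂ coefficient vanish at x = 1, where u = (1+i)/2; the price is two known
integrals, of arctan x/x and log(1+x²)/x. -/
theorem integral_log_one_add_sq_mul_arctan_div :
    ∫ x in (0 : ℝ)..1, log (1 + x ^ 2) * arctan x / x =
      2 * ArctanSums.W3 + log 2 * ArctanSums.catalan - π * log 2 ^ 2 / 16 - 3 * π ^ 3 / 64 := by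
  set e : ℂ := ((log 2 / 2 : ℝ) : ℂ) - ((π / 4 : ℝ) : ℂ) * Complex.I with he
  -- This is log(1-u) = log(-ix/(1-ix)).
  set lam : ℝ → ℂ := fun x =>
    ((log x : ℝ) : ℂ) - ((π / 2 : ℝ) : ℂ) * Complex.I - logOneAddMulI (-x) with hlam
  set F : ℝ → ℂ := fun x =>
    -lam x * (logOneAddMulI (-x) ^ 2 - 2 * e * logOneAddMulI (-x))
      - 2 * (e - logOneAddMulI (-x)) * ArctanSums.polylog 2 (1 - x * Complex.I)⁻¹
      + 2 * ArctanSums.polylog 3 (1 - x * Complex.I)⁻¹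
      - logOneAddMulI (-x) ^ 3 / 3 + e * logOneAddMulI (-x) ^ 2 with hF
  have hdF : ∀ x : ℝ, 0 < x → HasDerivAt F
      (-(logOneAddMulI (-x) ^ 2 - 2 * e * logOneAddMulI (-x)) / x) x := by
    intro x hx
    have n2 := one_sub_mul_I_ne_zero x
    have nx : (x : ℂ) ≠ 0 := by exact_mod_cast hx.ne'
    have ht : ‖((1 - x * Complex.I)⁻¹ : ℂ)‖ < 1 := by
      rw [norm_inv]
      refine inv_lt_one_of_one_lt₀ (lt_of_pow_lt_pow_left₀ 2 (norm_nonneg _) ?_)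
      rw [norm_one_sub_mul_I_sq]
      nlinarith
    have ht0 : ((1 - x * Complex.I)⁻¹ : ℂ) ≠ 0 := inv_ne_zero n2
    have hin : HasDerivAt (fun z : ℂ => (1 - z * Complex.I)⁻¹)
        (Complex.I / (1 - x * Complex.I) ^ 2) (x : ℂ) := by
      simpa using (((hasDerivAt_id (x : ℂ)).mul_const Complex.I).const_sub 1).fun_inv n2
    have d2 := ((hasDerivAt_polylog_two ht ht0).comp (x : ℂ) hin).comp_ofReal
    have d3 := ((hasDerivAt_polylog_succ 2 ht ht0).comp (x : ℂ) hin).comp_ofReal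
    have dq := hasDerivAt_logOneAddMulI_neg x
    have dl : HasDerivAt lam (((x⁻¹ : ℝ) : ℂ) - -Complex.I / (1 - x * Complex.I)) x :=
      ((hasDerivAt_log hx.ne').ofReal_comp.sub_const _).fun_sub dq
    have key := ((((dl.fun_neg.fun_mul ((dq.fun_pow 2).fun_sub (dq.const_mul (2 * e)))).fun_sub
      (((dq.const_sub e).const_mul 2).fun_mul d2)).fun_add (d3.const_mul 2)).fun_sub
      ((dq.fun_pow 3).div_const 3)).fun_add ((dq.fun_pow 2).const_mul e)
    refine key.congr_deriv ?_
    rw [log_one_sub_inv hx]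
    simp only [Function.comp, hlam]
    push_cast
    field_simp
    ring
  have hdf : ∀ x ∈ Ioo (0 : ℝ) 1, HasDerivAt (fun x => (F x).im)
      (log (1 + x ^ 2) * arctan x / x - log 2 * (arctan x / x)
        - π / 4 * (log (1 + x ^ 2) / x)) x := by
    intro x hx
    refine (hdF x hx.1).complex_im.congr_deriv ?_
    have e2 : logOneAddMulI (-x) = ((log (1 + x ^ 2) / 2 : ℝ) : ℂ)
        + ((-arctan x : ℝ) : ℂ) * Complex.I := by
      rw [logOneAddMulI, arctan_neg, even_two.neg_pow]
    rw [e2, he, Complex.div_ofReal_im]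
    simp only [pow_two, Complex.add_im, Complex.mul_im, Complex.add_re, Complex.mul_re,
      Complex.sub_re, Complex.sub_im, Complex.neg_im, Complex.re_ofNat, Complex.im_ofNat,
      Complex.ofReal_re, Complex.ofReal_im, Complex.I_re, Complex.I_im]
    have := hx.1.ne'
    field_simp
    ring
  have hpos : ∀ x : ℝ, ((1 - x * Complex.I)⁻¹ : ℂ) ∈ Metric.closedBall (0 : ℂ) 1 := by
    intro x
    rw [mem_closedBall_zero_iff, norm_inv]
    refine inv_le_one_of_one_le₀ (le_of_sq_le_sq ?_ (norm_nonneg _))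
    rw [norm_one_sub_mul_I_sq]
    nlinarith [sq_nonneg x]
  have hcp : ∀ s, 2 ≤ s → Continuous fun x : ℝ => ArctanSums.polylog s (1 - x * Complex.I)⁻¹ :=
    fun s hs => (continuousOn_polylog hs).comp_continuous
      (Continuous.inv₀ (by fun_prop) one_sub_mul_I_ne_zero) hpos
  have hcq : Continuous fun x : ℝ => logOneAddMulI (-x) :=
    continuous_logOneAddMulI.comp continuous_neg
  have t1 : Tendsto (fun x => (F x).im) (𝓝[<] 1) (𝓝 (F 1).im) :=
    (hdF 1 one_pos).complex_im.continuousAt.tendsto.mono_left nhdsWithin_le_nhds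
  have t0 : Tendsto (fun x => (F x).im) (𝓝[>] 0) (𝓝 (π ^ 3 / 12)) := by
    -- `G` is `F` without its log x term. It is continuous at 0, and the removed term log x · q(q -
    -- 2e) tends to 0 because q does so linearly.
    set G : ℝ → ℂ := fun x =>
      -(-(((π / 2 : ℝ) : ℂ) * Complex.I) - logOneAddMulI (-x)) *
          (logOneAddMulI (-x) ^ 2 - 2 * e * logOneAddMulI (-x))
        - 2 * (e - logOneAddMulI (-x)) * ArctanSums.polylog 2 (1 - x * Complex.I)⁻¹
        + 2 * ArctanSums.polylog 3 (1 - x * Complex.I)⁻¹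
        - logOneAddMulI (-x) ^ 3 / 3 + e * logOneAddMulI (-x) ^ 2 with hG
    have hGc : Continuous G := by
      have c2 := hcp 2 le_rfl
      have c3 := hcp 3 (by norm_num)
      simp only [hG]
      fun_prop
    have hG0 : Tendsto G (𝓝[>] 0) (𝓝 (G 0)) := (hGc.tendsto 0).mono_left nhdsWithin_le_nhds
    have hR : Tendsto (fun x : ℝ => ((log x : ℝ) : ℂ) * logOneAddMulI (-x) *
        (logOneAddMulI (-x) - 2 * e)) (𝓝[>] 0) (𝓝 (0 * (logOneAddMulI (-0) - 2 * e))) :=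
      tendsto_ofReal_log_mul_logOneAddMulI_neg.mul
        (((hcq.sub continuous_const).tendsto 0).mono_left nhdsWithin_le_nhds)
    have hFG := hG0.sub hR
    -- At x = 0 we have u = 1: Li₃(1) is real, and π³/12 is the imaginary part of -2e · π²/6.
    have hv : (G 0 - 0 * (logOneAddMulI (-0) - 2 * e)).im = π ^ 3 / 12 := by
      have z3 : (ArctanSums.polylog 3 1).im = 0 := by simpa using polylog_ofReal_im 3 1
      simp only [hG]
      rw [neg_zero, logOneAddMulI_zero, Complex.ofReal_zero, zero_mul, zero_mul, sub_zero (1 : ℂ),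
        inv_one, polylog_two_one, he]
      simp only [pow_succ, pow_zero, one_mul, zero_mul, mul_zero, sub_zero, zero_div, add_zero,
        Complex.add_im, Complex.mul_im, Complex.mul_re, Complex.sub_re, Complex.sub_im,
        Complex.zero_im, Complex.re_ofNat, Complex.im_ofNat, Complex.ofReal_re, Complex.ofReal_im, Complex.I_re,
        Complex.I_im, z3]
      ring
    rw [← hv]
    refine (Complex.continuous_im.tendsto _).comp (hFG.congr fun x => ?_)
    simp only [hF, hG, hlam]
    ring
  have iX := intervalIntegrable_log_one_add_sq_mul_arctan_div
  have iA := intervalIntegrable_arctan_div.const_mul (log 2)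
  have iL := intervalIntegrable_log_one_add_sq_div.const_mul (π / 4)
  have h := integral_eq_sub_of_hasDerivAt_of_tendsto zero_lt_one hdf ((iX.sub iA).sub iL) t0 t1
  rw [intervalIntegral.integral_sub (iX.sub iA) iL, intervalIntegral.integral_sub iX iA,
    intervalIntegral.integral_const_mul, intervalIntegral.integral_const_mul,
    integral_arctan_div, integral_log_one_add_sq_div] at h
  have hq1 : logOneAddMulI (-1) = e := logOneAddMulI_neg_one
  have hu : ((1 - Complex.I)⁻¹ : ℂ) = (1 + Complex.I) / 2 := by
    have n : (1 - Complex.I : ℂ) ≠ 0 := by simpa using one_sub_mul_I_ne_zero 1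
    rw [inv_eq_iff_eq_inv, inv_div, eq_div_iff (by simpa using one_add_mul_I_ne_zero 1)]
    linear_combination -Complex.I_sq
  have hF1 : (F 1).im = 2 * ArctanSums.W3 + 5 * π ^ 3 / 192 - π * log 2 ^ 2 / 16 := by
    have e1 : F 1 = (((π / 2 : ℝ) : ℂ) * Complex.I + e) * -e ^ 2
        + 2 * ArctanSums.polylog 3 ((1 + Complex.I) / 2) + 2 / 3 * e ^ 3 := by
      simp only [hF, hlam]
      rw [hq1, log_one, Complex.ofReal_one, one_mul, hu]
      push_cast; ring
    rw [e1, he]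
    simp only [pow_succ, pow_zero, one_mul, Complex.add_im, Complex.mul_im, Complex.add_re,
      Complex.mul_re,
      Complex.sub_re, Complex.sub_im, Complex.neg_im, Complex.neg_re,
      Complex.re_ofNat, Complex.im_ofNat, Complex.div_ofNat_im, Complex.div_ofNat_re,
      Complex.ofReal_re, Complex.ofReal_im, Complex.I_re, Complex.I_im]
    rw [show (ArctanSums.polylog 3 ((1 + Complex.I) / 2)).im = ArctanSums.W3 from rfl]
    ring
  rw [hF1] at h
  linarith

theorem integral_log_one_add_sq_sq :
    ∫ x in (0 : ℝ)..1, log (1 + x ^ 2) ^ 2 / (1 + x ^ 2) =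
      4 * ArctanSums.W3 - 7 * π ^ 3 / 96 + 7 * π * log 2 ^ 2 / 8
        - 2 * log 2 * ArctanSums.catalan := by
  have i0 : IntervalIntegrable (fun x : ℝ => 1 / (1 + x ^ 2)) volume 0 1 :=
    intervalIntegrable_div_one_add_sq (continuous_const.intervalIntegrable _ _)
  have i1 : IntervalIntegrable (fun x : ℝ => log (1 + x ^ 2) / (1 + x ^ 2)) volume 0 1 :=
    intervalIntegrable_div_one_add_sq (continuous_log_one_add_sq.intervalIntegrable _ _)
  have i2 : IntervalIntegrable (fun x : ℝ => log (1 + x ^ 2) ^ 2 / (1 + x ^ 2)) volume 0 1 :=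
    intervalIntegrable_div_one_add_sq ((continuous_log_one_add_sq.pow 2).intervalIntegrable _ _)
  have e : ∀ x : ℝ, (log (1 + x ^ 2) - log 2) ^ 2 / (1 + x ^ 2) =
      log (1 + x ^ 2) ^ 2 / (1 + x ^ 2) - 2 * log 2 * (log (1 + x ^ 2) / (1 + x ^ 2))
        + log 2 ^ 2 * (1 / (1 + x ^ 2)) := fun x => by ring
  have h := integral_log_one_add_sq_sub_sq
  simp_rw [e] at h
  rw [intervalIntegral.integral_add (i2.sub (i1.const_mul _)) (i0.const_mul _),
    intervalIntegral.integral_sub i2 (i1.const_mul _), intervalIntegral.integral_const_mul,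
    intervalIntegral.integral_const_mul, integral_one_div_one_add_sq_zero_one,
    integral_log_one_add_sq_div_one_add_sq] at h
  linarith

/-- The product log x · arctan x · log(1+x²) tends to 0 at both ends, so the three integrals in its
derivative sum to zero; the other two are known, one through log²(1+x²). -/
theorem integral_mul_log_mul_arctan_div_one_add_sq :
    ∫ x in (0 : ℝ)..1, x / (1 + x ^ 2) * (arctan x * log x) =
      π ^ 3 / 32 + π * log 2 ^ 2 / 16 - 2 * ArctanSums.W3 := by
  have hc : Continuous fun x : ℝ => x / (1 + x ^ 2) * arctan x := by
    have := continuous_pow_div_one_add_sq 1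
    simp only [pow_one] at this
    exact this.mul continuous_arctan
  have i1 : IntervalIntegrable (fun x : ℝ => 2 * (x / (1 + x ^ 2) * (arctan x * log x)))
      volume 0 1 := by
    simpa only [mul_assoc] using (intervalIntegrable_mul_log hc 0 1).const_mul 2
  have i2 := intervalIntegrable_log_one_add_sq_mul_arctan_div
  have i3 : IntervalIntegrable (fun x : ℝ => log x * log (1 + x ^ 2) / (1 + x ^ 2)) volume 0 1 :=
    intervalIntegrable_div_one_add_sq
      (intervalIntegrable_log'.mul_continuousOn continuous_log_one_add_sq.continuousOn)
  have hd : ∀ x : ℝ, 0 < x → HasDerivAt (fun x => log x * arctan x * log (1 + x ^ 2))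
      (2 * (x / (1 + x ^ 2) * (arctan x * log x)) + log (1 + x ^ 2) * arctan x / x
        + log x * log (1 + x ^ 2) / (1 + x ^ 2)) x := by
    intro x hx
    refine (((hasDerivAt_log hx.ne').fun_mul (hasDerivAt_arctan x)).fun_mul
      (hasDerivAt_log_one_add_sq x)).congr_deriv ?_
    ring
  have t0 : Tendsto (fun x => log x * arctan x * log (1 + x ^ 2)) (𝓝[>] 0) (𝓝 0) := by
    have := tendsto_log_mul_arctan_zero.mul
      ((continuous_log_one_add_sq.tendsto 0).mono_left (nhdsWithin_le_nhds (s := Ioi 0)))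
    simpa using this
  have t1 : Tendsto (fun x => log x * arctan x * log (1 + x ^ 2)) (𝓝[<] 1) (𝓝 0) := by
    have := (hd 1 one_pos).continuousAt.tendsto.mono_left (nhdsWithin_le_nhds (s := Iio 1))
    simpa using this
  have h := integral_eq_sub_of_hasDerivAt_of_tendsto zero_lt_one (fun x hx => hd x hx.1)
    ((i1.add i2).add i3) t0 t1
  rw [intervalIntegral.integral_add (i1.add i2) i3, intervalIntegral.integral_add i1 i2,
    intervalIntegral.integral_const_mul, integral_log_one_add_sq_mul_arctan_div,
    integral_log_mul_log_one_add_sq_div_one_add_sq, integral_log_one_add_sq_sq] at h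
  linarith

/-! ### The integral of θ² log tan θ by Fourier series -/

theorem norm_one_sub_mul_exp_sq (r φ : ℝ) :
    ‖(1 - r * Complex.exp (φ * Complex.I) : ℂ)‖ ^ 2 = 1 - 2 * r * cos φ + r ^ 2 := by
  rw [← Complex.normSq_eq_norm_sq, Complex.normSq_apply]
  simp only [Complex.sub_re, Complex.sub_im, Complex.mul_re, Complex.mul_im, Complex.ofReal_re,
    Complex.ofReal_im, Complex.exp_ofReal_mul_I_re, Complex.exp_ofReal_mul_I_im, Complex.one_re,
    Complex.one_im]
  linear_combination r ^ 2 * sin_sq_add_cos_sq φ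

theorem hasSum_pow_mul_cos_div {r : ℝ} (hr : |r| < 1) (φ : ℝ) :
    HasSum (fun n : ℕ => r ^ n * cos (n * φ) / n) (-(log (1 - 2 * r * cos φ + r ^ 2) / 2)) := by
  have hz : ‖(r * Complex.exp (φ * Complex.I) : ℂ)‖ < 1 := by
    rw [norm_mul, Complex.norm_exp_ofReal_mul_I, mul_one, Complex.norm_real]; exact hr
  have h := Complex.hasSum_re (Complex.hasSum_taylorSeries_neg_log hz)
  rw [Complex.neg_re, Complex.log_re] at h
  convert! h using 1
  · ext n
    rw [mul_pow, ← Complex.exp_nat_mul, ← Complex.ofReal_pow, Complex.div_natCast_re,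
      Complex.re_ofReal_mul, show (n : ℂ) * (φ * Complex.I) = ((n * φ : ℝ) : ℂ) * Complex.I by
        push_cast; ring, Complex.exp_ofReal_mul_I_re]
  · rw [← norm_one_sub_mul_exp_sq, log_pow]; push_cast; ring

/-- Half the difference of the series at r and -r keeps the odd frequencies. At r = 1 the right-hand
side is formally -(1/2) log tan(φ/2). -/
theorem hasSum_odd_pow_mul_cos_div {r : ℝ} (hr : |r| < 1) (φ : ℝ) :
    HasSum (fun n : ℕ => r ^ (2 * n + 1) * cos ((2 * n + 1 : ℕ) * φ) / (2 * n + 1 : ℕ))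
      ((log (1 + 2 * r * cos φ + r ^ 2) - log (1 - 2 * r * cos φ + r ^ 2)) / 4) := by
  have h1 := hasSum_pow_mul_cos_div hr φ
  have h2 := hasSum_pow_mul_cos_div (r := -r) (by rwa [abs_neg]) φ
  have h := (h1.sub h2).div_const 2
  have hinj : Function.Injective fun n : ℕ => 2 * n + 1 := fun a b h => by simpa using h
  rw [← hinj.hasSum_iff] at h
  · convert! h using 1
    · ext n
      simp only [Function.comp]
      rw [neg_pow r, pow_succ (-1 : ℝ), pow_mul]
      norm_num
      ring
    · ring_nf
  · intro n hn
    have he : Even n := by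
      by_contra h
      rw [Nat.not_even_iff_odd] at h
      obtain ⟨m, rfl⟩ := h
      exact hn ⟨m, rfl⟩
    rw [he.neg_pow]; simp

theorem integral_sq_mul_cos (n : ℕ) :
    ∫ θ in (0 : ℝ)..(π / 4), θ ^ 2 * cos ((2 * n + 1 : ℕ) * (2 * θ)) =
      (-1) ^ n * (π ^ 2 / 32 / (2 * (n : ℝ) + 1) - 1 / 4 / (2 * (n : ℝ) + 1) ^ 3) := by
  have hm : (2 * (n : ℝ) + 1) ≠ 0 := by positivity
  set a : ℝ := 2 * (2 * (n : ℝ) + 1) with ha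
  have ha0 : a ≠ 0 := by positivity
  have h := integral_eq_sub_of_hasDerivAt (a := 0) (b := π / 4)
    (f := fun θ => θ ^ 2 * sin (a * θ) / a + 2 * θ * cos (a * θ) / a ^ 2 - 2 * sin (a * θ) / a ^ 3)
    (f' := fun θ => θ ^ 2 * cos (a * θ)) (fun θ _ => by
      have hs : HasDerivAt (fun θ => sin (a * θ)) (a * cos (a * θ)) θ := by
        simpa [mul_comm] using ((hasDerivAt_id θ).const_mul a).sin
      have hc : HasDerivAt (fun θ => cos (a * θ)) (-(a * sin (a * θ))) θ := by
        simpa [mul_comm] using ((hasDerivAt_id θ).const_mul a).cos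
      refine (((((hasDerivAt_pow 2 θ).fun_mul hs).div_const a).fun_add
        ((((hasDerivAt_id θ).const_mul 2).fun_mul hc).div_const (a ^ 2))).fun_sub
        ((hs.const_mul 2).div_const (a ^ 3))).congr_deriv ?_
      simp
      field_simp
      ring) (by apply Continuous.intervalIntegrable; fun_prop)
  have e : ∀ θ : ℝ, ((2 * n + 1 : ℕ) : ℝ) * (2 * θ) = a * θ := fun θ => by
    rw [ha]; push_cast; ring
  simp_rw [e]
  -- At the upper limit the sine is (-1)^n and the cosine is 0.
  have e1 : a * (π / 4) = n * π + π / 2 := by rw [ha]; ring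
  rw [h, e1, sin_add_pi_div_two, cos_add_pi_div_two, cos_nat_mul_pi, sin_nat_mul_pi, ha]
  simp
  field_simp
  ring

theorem integral_sq_mul_log_sub_log {r : ℝ} (hr0 : 0 ≤ r) (hr : r < 1) :
    HasSum (fun n : ℕ => r ^ (2 * n + 1) * (π ^ 2 / 16 * ((-1) ^ n / (2 * (n : ℝ) + 1) ^ 2)
        - 1 / 2 * ((-1) ^ n / (2 * (n : ℝ) + 1) ^ 4)))
      (∫ θ in (0 : ℝ)..(π / 4), θ ^ 2 *
        ((log (1 + 2 * r * cos (2 * θ) + r ^ 2) - log (1 - 2 * r * cos (2 * θ) + r ^ 2)) / 2)) := by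
  have hr' : |r| < 1 := by rwa [abs_of_nonneg hr0]
  have hF : ∀ θ : ℝ, HasSum (fun n : ℕ => 2 * (r ^ (2 * n + 1) / (2 * n + 1 : ℕ)) *
      (θ ^ 2 * cos ((2 * n + 1 : ℕ) * (2 * θ)))) (θ ^ 2 *
        ((log (1 + 2 * r * cos (2 * θ) + r ^ 2) - log (1 - 2 * r * cos (2 * θ) + r ^ 2)) / 2)) := by
    intro θ
    convert! (hasSum_odd_pow_mul_cos_div hr' (2 * θ)).mul_left (2 * θ ^ 2) using 1
    · ext n; ring
    · ring
  have h := intervalIntegral.hasSum_integral_of_dominated_convergence (a := 0) (b := π / 4)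
    (μ := volume)
    (F := fun (n : ℕ) θ => 2 * (r ^ (2 * n + 1) / (2 * n + 1 : ℕ)) *
      (θ ^ 2 * cos ((2 * n + 1 : ℕ) * (2 * θ))))
    (bound := fun n _ => 2 * (r ^ 2) ^ n)
    (fun n => (Continuous.aestronglyMeasurable (by fun_prop)))
    (fun n => by
      filter_upwards with θ hθ
      rw [uIoc_of_le (by positivity)] at hθ
      have h1 : θ ^ 2 ≤ 1 := pow_le_one₀ hθ.1.le (by linarith [hθ.2, pi_lt_four])
      have h2 : |cos ((2 * n + 1 : ℕ) * (2 * θ))| ≤ 1 := abs_cos_le_one _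
      have h3 : r ^ (2 * n + 1) / (2 * n + 1 : ℕ) ≤ (r ^ 2) ^ n := by
        rw [← pow_mul]
        refine (div_le_self (by positivity) ?_).trans (pow_le_pow_of_le_one hr0 hr.le (by omega))
        exact_mod_cast (by omega : 1 ≤ 2 * n + 1)
      rw [norm_mul, norm_mul, norm_mul, Real.norm_eq_abs (cos _), norm_pow, Real.norm_eq_abs θ,
        sq_abs, Real.norm_of_nonneg (by positivity), Real.norm_of_nonneg (by positivity)]
      calc 2 * (r ^ (2 * n + 1) / (2 * n + 1 : ℕ)) * (θ ^ 2 * |cos ((2 * n + 1 : ℕ) * (2 * θ))|)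
          ≤ 2 * (r ^ 2) ^ n * (1 * 1) := by gcongr
        _ = 2 * (r ^ 2) ^ n := by ring)
    (by
      filter_upwards with θ _
      exact (summable_geometric_of_lt_one (by positivity)
        (pow_lt_one₀ hr0 hr two_ne_zero)).mul_left 2)
    (by simp)
    (by filter_upwards with θ _ using hF θ)
  convert! h using 2 with n
  rw [intervalIntegral.integral_const_mul, integral_sq_mul_cos]
  have hm : (2 * (n : ℝ) + 1) ≠ 0 := by positivity
  push_cast
  field_simp
  ring

/-- Abel summation: for r < 1 termwise integration is dominated by a geometric series, and only the
integrated series, which is absolutely summable at r = 1, is passed to the limit. -/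
theorem tendsto_integral_sq_mul_log_sub_log :
    Tendsto (fun r : ℝ => ∫ θ in (0 : ℝ)..(π / 4), θ ^ 2 *
        ((log (1 + 2 * r * cos (2 * θ) + r ^ 2) - log (1 - 2 * r * cos (2 * θ) + r ^ 2)) / 2))
      (𝓝[<] 1) (𝓝 (π ^ 2 / 16 * ArctanSums.catalan - ArctanSums.dirichletBeta 4 / 2)) := by
  set u : ℕ → ℝ := fun n => π ^ 2 / 16 * ((-1) ^ n / (2 * (n : ℝ) + 1) ^ 2)
        - 1 / 2 * ((-1) ^ n / (2 * (n : ℝ) + 1) ^ 4) with hu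
  have hs : HasSum u (π ^ 2 / 16 * ArctanSums.catalan - ArctanSums.dirichletBeta 4 / 2) := by
    have := ((hasSum_dirichletBeta (le_refl 2)).mul_left (π ^ 2 / 16)).sub
      ((hasSum_dirichletBeta (s := 4) (by norm_num)).mul_left (1 / 2))
    convert! this using 1
    rw [ArctanSums.catalan]; ring
  have hev : ∀ᶠ r : ℝ in 𝓝[<] 1, 0 ≤ r ∧ r < 1 := by
    filter_upwards [Ioo_mem_nhdsLT (show (0 : ℝ) < 1 by norm_num)] with r hr
    exact ⟨hr.1.le, hr.2⟩
  have h := tendsto_tsum_of_dominated_convergence (𝓕 := 𝓝[<] (1 : ℝ))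
    (f := fun r (n : ℕ) => r ^ (2 * n + 1) * u n) (g := u) (bound := fun n => |u n|)
    hs.summable.abs
    (fun n => by
      have : Tendsto (fun r : ℝ => r ^ (2 * n + 1) * u n) (𝓝 1) (𝓝 (1 ^ (2 * n + 1) * u n)) :=
        Continuous.tendsto (by fun_prop) 1
      rw [one_pow, one_mul] at this
      exact this.mono_left nhdsWithin_le_nhds)
    (by
      filter_upwards [hev] with r hr n
      rw [norm_mul, Real.norm_eq_abs (u n), norm_pow, Real.norm_of_nonneg hr.1]
      exact mul_le_of_le_one_left (abs_nonneg _) (pow_le_one₀ hr.1 hr.2.le))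
  rw [hs.tsum_eq] at h
  refine h.congr' ?_
  filter_upwards [hev] with r hr
  exact (integral_sq_mul_log_sub_log hr.1 hr.2).tsum_eq

/-- The limit r → 1 of the same integrals is taken a second time, under the integral sign, where the
logarithms become log of 4cos²θ and 4sin²θ. Uniqueness of limits gives the value. -/
theorem integral_sq_mul_log_tan :
    ∫ θ in (0 : ℝ)..(π / 4), θ ^ 2 * log (tan θ) =
      ArctanSums.dirichletBeta 4 / 2 - ArctanSums.catalan * π ^ 2 / 16 := by
  have hcos : ∀ θ ∈ Ioc (0 : ℝ) (π / 4), 0 < sin θ ∧ 0 < cos θ ∧ 0 ≤ cos (2 * θ) := by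
    intro θ hθ
    exact ⟨sin_pos_of_pos_of_lt_pi hθ.1 (by linarith [hθ.2, pi_pos]),
      cos_pos_of_mem_Ioo ⟨by linarith [hθ.1, pi_pos], by linarith [hθ.2, pi_pos]⟩,
      cos_nonneg_of_mem_Icc ⟨by linarith [hθ.1, pi_pos], by linarith [hθ.2, pi_pos]⟩⟩
  have h := intervalIntegral.tendsto_integral_filter_of_dominated_convergence
    (μ := volume) (a := 0) (b := π / 4) (l := 𝓝[<] (1 : ℝ))
    (F := fun r θ => θ ^ 2 *
      ((log (1 + 2 * r * cos (2 * θ) + r ^ 2) - log (1 - 2 * r * cos (2 * θ) + r ^ 2)) / 2))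
    (f := fun θ => -(θ ^ 2 * log (tan θ)))
    (bound := fun θ => -(log (sin θ) + log (cos θ)))
    (Eventually.of_forall fun r => Measurable.aestronglyMeasurable (by fun_prop))
    (by
      filter_upwards [Ioo_mem_nhdsLT (show (0 : ℝ) < 1 by norm_num)] with r hr
      filter_upwards with θ hθ
      rw [uIoc_of_le (by positivity)] at hθ
      obtain ⟨hs, hc, hc2⟩ := hcos θ hθ
      have h1 : θ ^ 2 ≤ 1 := pow_le_one₀ hθ.1.le (by linarith [hθ.2, pi_lt_four])
      have hrc : 0 ≤ r * cos (2 * θ) := mul_nonneg hr.1.le hc2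
      have hsc : 0 < (2 * sin θ * cos θ) ^ 2 := by positivity
      -- Completing the square: 1 - 2rc + r² = (r - c)² + sin²2θ with c = cos 2θ. With the upper
      -- bound 4 for the other logarithm, this gives the integrable bound -(log sin θ + log cos θ).
      have hlow : (2 * sin θ * cos θ) ^ 2 ≤ 1 - 2 * r * cos (2 * θ) + r ^ 2 := by
        rw [← sin_two_mul]
        nlinarith [sin_sq_add_cos_sq (2 * θ), sq_nonneg (r - cos (2 * θ))]
      have hhigh : 1 + 2 * r * cos (2 * θ) + r ^ 2 ≤ 2 ^ 2 := by
        have := mul_le_of_le_one_right hr.1.le (cos_le_one (2 * θ))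
        nlinarith [hr.1, hr.2]
      have l1 := log_le_log (by nlinarith) hhigh
      have l2 := log_le_log hsc hlow
      have l3 := log_le_log (hsc.trans_le hlow)
        (show 1 - 2 * r * cos (2 * θ) + r ^ 2 ≤ 1 + 2 * r * cos (2 * θ) + r ^ 2 by linarith)
      rw [log_pow, log_mul (by positivity) hc.ne', log_mul two_ne_zero hs.ne'] at l2
      rw [log_pow] at l1
      push_cast at l1 l2
      rw [Real.norm_of_nonneg (mul_nonneg (sq_nonneg θ) (by linarith))]
      refine (mul_le_of_le_one_left (by linarith) h1).trans (by linarith))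
    ((intervalIntegrable_log_sin.add intervalIntegrable_log_cos).neg)
    (by
      filter_upwards with θ hθ
      rw [uIoc_of_le (by positivity)] at hθ
      obtain ⟨hs, hc, hc2⟩ := hcos θ hθ
      have e1 : 1 + 2 * 1 * cos (2 * θ) + 1 ^ 2 = 4 * cos θ ^ 2 := by rw [cos_two_mul]; ring
      have e2 : 1 - 2 * 1 * cos (2 * θ) + 1 ^ 2 = 4 * sin θ ^ 2 := by
        rw [cos_two_mul]; linear_combination -4 * sin_sq_add_cos_sq θ
      have hct : ContinuousAt (fun r => θ ^ 2 * ((log (1 + 2 * r * cos (2 * θ) + r ^ 2)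
          - log (1 - 2 * r * cos (2 * θ) + r ^ 2)) / 2)) 1 := by
        refine continuousAt_const.mul (((ContinuousAt.log (by fun_prop) ?_).sub
          (ContinuousAt.log (by fun_prop) ?_)).div_const 2)
        · rw [e1]; positivity
        · rw [e2]; positivity
      have := hct.tendsto
      rw [e1, e2, log_mul four_ne_zero (by positivity), log_mul four_ne_zero (by positivity),
        log_pow, log_pow] at this
      convert! this.mono_left nhdsWithin_le_nhds using 2
      rw [tan_eq_sin_div_cos, log_div hs.ne' hc.ne']
      push_cast; ring)
  have := tendsto_nhds_unique h tendsto_integral_sq_mul_log_sub_log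
  rw [intervalIntegral.integral_neg] at this
  linarith

theorem integral_arctan_sq_mul_log_div_one_add_sq :
    ∫ x in (0 : ℝ)..1, 1 / (1 + x ^ 2) * (arctan x ^ 2 * log x) =
      ArctanSums.dirichletBeta 4 / 2 - ArctanSums.catalan * π ^ 2 / 16 := by
  rw [← integral_sq_mul_log_tan, ← integral_comp_arctan fun θ => θ ^ 2 * log (tan θ)]
  simp_rw [tan_arctan, one_div_mul_eq_div]

theorem integral_arctan_sq_div_one_add_sq :
    ∫ x in (0 : ℝ)..1, 1 / (1 + x ^ 2) * arctan x ^ 2 = π ^ 3 / 192 := by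
  have h := integral_comp_arctan fun θ => θ ^ 2
  simp_rw [one_div_mul_eq_div]
  rw [h, integral_pow]
  ring

/-! ### The power series of arctan²x/(1+x²) and the logarithmic weight -/

theorem oddHarmonic_succ_eq (n : ℕ) :
    ArctanSums.oddHarmonic (n + 1) = ∑ a ∈ Finset.range (n + 1), 1 / (2 * (a : ℝ) + 1) := by
  rw [ArctanSums.oddHarmonic, Finset.range_eq_Ico, ← Finset.Ico_add_one_right_eq_Icc,
    ← Finset.sum_Ico_add' _ 0 (n + 1) 1]
  refine Finset.sum_congr rfl fun a _ => ?_
  push_cast; congr 1; ring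

/-- Partial fractions: 1/((2a+1)(2b+1)) = (1/(2a+1) + 1/(2b+1))/(2(a+b+1)), and reflecting the index
makes the two halves equal. These are the Cauchy coefficients of arctan². -/
theorem sum_one_div_odd_mul_odd (n : ℕ) :
    ∑ a ∈ Finset.range (n + 1), 1 / ((2 * (a : ℝ) + 1) * (2 * ((n - a : ℕ) : ℝ) + 1)) =
      ArctanSums.oddHarmonic (n + 1) / ((n : ℝ) + 1) := by
  have hr := Finset.sum_range_reflect (fun a : ℕ => 1 / (2 * (a : ℝ) + 1)) (n + 1)
  have h : ∀ a ∈ Finset.range (n + 1),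
      1 / ((2 * (a : ℝ) + 1) * (2 * ((n - a : ℕ) : ℝ) + 1)) =
        (1 / (2 * (a : ℝ) + 1) + 1 / (2 * ((n + 1 - 1 - a : ℕ) : ℝ) + 1)) / (2 * ((n : ℝ) + 1)) := by
    intro a ha
    obtain ⟨b, rfl⟩ : ∃ b, n = a + b := ⟨n - a, by simp at ha; omega⟩
    rw [show a + b - a = b by omega, show a + b + 1 - 1 - a = b by omega]
    have h1 : (2 * (a : ℝ) + 1) ≠ 0 := by positivity
    have h2 : (2 * (b : ℝ) + 1) ≠ 0 := by positivity
    have h3 : ((a : ℝ) + b + 1) ≠ 0 := by positivity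
    push_cast
    field_simp
    ring
  rw [Finset.sum_congr rfl h, ← Finset.sum_div, Finset.sum_add_distrib, hr, oddHarmonic_succ_eq]
  have h3 : ((n : ℝ) + 1) ≠ 0 := by positivity
  field_simp
  ring

/-- The partial sums `∑_{i = 1}^{n + 1} h_i / i`. -/
noncomputable def oddHarmonicSum (n : ℕ) : ℝ :=
  ∑ a ∈ Finset.range (n + 1), ArctanSums.oddHarmonic (a + 1) / ((a : ℝ) + 1)

theorem oddHarmonic_succ_nonneg (n : ℕ) : 0 ≤ ArctanSums.oddHarmonic (n + 1) := by
  rw [oddHarmonic_succ_eq]; positivity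

theorem oddHarmonic_succ_le (n : ℕ) : ArctanSums.oddHarmonic (n + 1) ≤ (n : ℝ) + 1 := by
  rw [oddHarmonic_succ_eq]
  refine (Finset.sum_le_card_nsmul _ _ 1 fun a _ => ?_).trans (by simp)
  exact div_le_one_of_le₀ (by linarith [a.cast_nonneg (α := ℝ)]) (by positivity)

theorem oddHarmonicSum_nonneg (n : ℕ) : 0 ≤ oddHarmonicSum n :=
  Finset.sum_nonneg fun a _ => div_nonneg (oddHarmonic_succ_nonneg a) (by positivity)

theorem oddHarmonicSum_le (n : ℕ) : oddHarmonicSum n ≤ (n : ℝ) + 1 := by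
  refine (Finset.sum_le_card_nsmul _ _ 1 fun a _ => ?_).trans (by simp)
  exact div_le_one_of_le₀ (oddHarmonic_succ_le a) (by positivity)

theorem hasSum_arctan_sq {x : ℝ} (hx : x ∈ Ioo (0 : ℝ) 1) :
    HasSum (fun n : ℕ => (-1 : ℝ) ^ n * x ^ (2 * n + 2) *
      (ArctanSums.oddHarmonic (n + 1) / ((n : ℝ) + 1))) (arctan x ^ 2) := by
  have h := Real.hasSum_arctan (x := x) (by
    rw [Real.norm_eq_abs, abs_of_pos hx.1]; exact hx.2)
  have h2 := hasSum_sum_range_mul_of_summable_norm h.summable.norm h.summable.norm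
  rw [h.tsum_eq, ← pow_two] at h2
  convert! h2 using 2 with n
  rw [← sum_one_div_odd_mul_odd, Finset.mul_sum]
  refine Finset.sum_congr rfl fun a ha => ?_
  obtain ⟨b, rfl⟩ : ∃ b, n = a + b := ⟨n - a, by simp at ha; omega⟩
  rw [show a + b - a = b by omega]
  push_cast
  field_simp
  ring

theorem hasSum_arctan_sq_div_one_add_sq {x : ℝ} (hx : x ∈ Ioo (0 : ℝ) 1) :
    HasSum (fun n : ℕ => (-1 : ℝ) ^ n * oddHarmonicSum n * x ^ (2 * n + 2))
      (arctan x ^ 2 * (1 / (1 + x ^ 2))) := by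
  have h1 := hasSum_arctan_sq hx
  have h2 := hasSum_neg_one_pow_mul_pow hx
  have h := hasSum_sum_range_mul_of_summable_norm h1.summable.norm h2.summable.norm
  rw [h1.tsum_eq, h2.tsum_eq] at h
  convert! h using 2 with n
  rw [oddHarmonicSum, Finset.mul_sum, Finset.sum_mul]
  refine Finset.sum_congr rfl fun a ha => ?_
  obtain ⟨b, rfl⟩ : ∃ b, n = a + b := ⟨n - a, by simp at ha; omega⟩
  rw [show a + b - a = b by omega]
  ring

/-- The weight `x ^ N log x / N + (1 - x ^ N) / N ^ 2`. -/
noncomputable def logWeight (N : ℕ) (x : ℝ) : ℝ :=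
  x ^ N * log x / N + (1 - x ^ N) / (N : ℝ) ^ 2

theorem logWeight_nonneg {N : ℕ} (hN : N ≠ 0) {x : ℝ} (hx : 0 < x) : 0 ≤ logWeight N x := by
  have hN' : (0 : ℝ) < N := by positivity
  have hy : 0 < x ^ N := by positivity
  -- With y = x^N, the weight is (y log y + 1 - y)/N², nonnegative by log(1/y) ≤ 1/y - 1.
  have h := log_le_sub_one_of_pos (inv_pos.2 hy)
  rw [log_inv, log_pow] at h
  have h2 : 0 ≤ x ^ N * (N * log x) + 1 - x ^ N := by
    have h3 := mul_le_mul_of_nonneg_left h hy.le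
    rw [mul_sub, mul_inv_cancel₀ hy.ne'] at h3
    linarith
  have e : logWeight N x = (x ^ N * (N * log x) + 1 - x ^ N) / (N : ℝ) ^ 2 := by
    rw [logWeight]; field_simp; ring
  rw [e]; positivity

/-- The weight is the antiderivative of x^(N-1) log x vanishing at 1, so one integration by parts
would produce the simple factor n+1 and leave the log moment with the squared factor n+N+1. -/
theorem integral_pow_mul_logWeight {N : ℕ} (hN : N ≠ 0) (n : ℕ) :
    ∫ x in (0 : ℝ)..1, x ^ n * logWeight N x =
      1 / (((n : ℝ) + 1) * ((n : ℝ) + N + 1) ^ 2) := by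
  have e : ∀ x : ℝ, x ^ n * logWeight N x = 1 / N * (x ^ (n + N) * log x) +
      1 / (N : ℝ) ^ 2 * (x ^ n - x ^ (n + N)) := fun x => by
    rw [logWeight, pow_add]; ring
  simp_rw [e]
  rw [intervalIntegral.integral_add
    ((intervalIntegrable_mul_log (by fun_prop) 0 1).const_mul _)
    (by apply Continuous.intervalIntegrable; fun_prop),
    intervalIntegral.integral_const_mul, intervalIntegral.integral_const_mul,
    intervalIntegral.integral_sub (by simp) (by simp), integral_pow, integral_pow,
    integral_pow_mul_log]
  have hN' : (N : ℝ) ≠ 0 := by positivity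
  have h1 : (n : ℝ) + 1 ≠ 0 := by positivity
  have h2 : (n : ℝ) + N + 1 ≠ 0 := by positivity
  push_cast
  simp
  field_simp
  ring

theorem intervalIntegrable_mul_logWeight {f : ℝ → ℝ} (hf : Continuous f) (N : ℕ) :
    IntervalIntegrable (fun x => f x * logWeight N x) volume 0 1 := by
  have e : (fun x => f x * logWeight N x) = fun x => 1 / N * (f x * x ^ N * log x) +
      f x * (1 - x ^ N) * (1 / (N : ℝ) ^ 2) := by
    ext x; rw [logWeight]; ring
  rw [e]
  exact ((intervalIntegrable_mul_log (by fun_prop) 0 1).const_mul _).add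
    (by apply Continuous.intervalIntegrable; fun_prop)

theorem hasSum_oddHarmonicSum (k : ℕ) :
    HasSum (fun n : ℕ => -3 * (-1 : ℝ) ^ n * oddHarmonicSum n /
        ((2 * (n : ℝ) + 3) * (2 * (n : ℝ) + 2 * k + 5) ^ 2))
      (-3 * ∫ x in (0 : ℝ)..1, arctan x ^ 2 * (1 / (1 + x ^ 2)) * logWeight (2 * k + 2) x) := by
  have hN : 2 * k + 2 ≠ 0 := by omega
  have hi : ∀ n : ℕ, -3 * (-1 : ℝ) ^ n * oddHarmonicSum n *
      ∫ x in (0 : ℝ)..1, x ^ (2 * n + 2) * logWeight (2 * k + 2) x =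
      -3 * (-1 : ℝ) ^ n * oddHarmonicSum n /
        ((2 * (n : ℝ) + 3) * (2 * (n : ℝ) + 2 * k + 5) ^ 2) := by
    intro n
    rw [integral_pow_mul_logWeight hN, mul_one_div]
    push_cast
    congr 2 <;> ring
  have h := hasSum_mul_integral_zero_one (c := fun n => -3 * (-1 : ℝ) ^ n * oddHarmonicSum n)
    (g := fun n x => x ^ (2 * n + 2) * logWeight (2 * k + 2) x)
    (F := fun x => -3 * (arctan x ^ 2 * (1 / (1 + x ^ 2)) * logWeight (2 * k + 2) x))
    (fun n => intervalIntegrable_mul_logWeight (by fun_prop) _)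
    (fun n x hx => mul_nonneg (pow_nonneg hx.1.le _) (logWeight_nonneg hN hx.1))
    (fun x hx => by
      convert! ((hasSum_arctan_sq_div_one_add_sq hx).mul_right
        (logWeight (2 * k + 2) x)).mul_left (-3) using 2 with n
      ring)
    (by
      simp_rw [hi]
      -- The crude bound S_n ≤ n+1 suffices against the cubic denominator.
      refine Summable.of_norm_bounded ((summable_one_div_succ_pow (le_refl 2)).mul_left 3)
        fun n => ?_
      rw [norm_div, norm_mul, norm_mul, norm_pow, Real.norm_of_nonneg (oddHarmonicSum_nonneg n),
        norm_neg, norm_neg, norm_one, one_pow, Real.norm_ofNat, mul_one,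
        Real.norm_of_nonneg (by positivity), mul_div_assoc]
      refine mul_le_mul_of_nonneg_left ?_ (by norm_num)
      have hn : (0 : ℝ) ≤ n := n.cast_nonneg
      have hk : (0 : ℝ) ≤ k := k.cast_nonneg
      rw [div_le_div_iff₀ (by positivity) (by positivity), one_mul]
      exact mul_le_mul ((oddHarmonicSum_le n).trans (by linarith))
        (pow_le_pow_left₀ (by positivity) (by linarith) 2) (by positivity) (by positivity))
  simp_rw [hi] at h
  rwa [intervalIntegral.integral_const_mul] at h

theorem milgram_two_eq (n : ℕ) : ArctanSums.milgram 2 n = 2 * oddHarmonicSum n := by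
  have h1 : ∀ m, ArctanSums.milgram 1 m = 2 * ArctanSums.oddHarmonic (m + 1) := fun m => by
    rw [ArctanSums.milgram, oddHarmonic_succ_eq, Finset.mul_sum]
    refine Finset.sum_congr rfl fun a _ => ?_
    have : (2 * (a : ℝ) + 1) ≠ 0 := by positivity
    rw [ArctanSums.milgram]
    push_cast
    field_simp
    ring
  rw [ArctanSums.milgram, oddHarmonicSum, Finset.mul_sum]
  refine Finset.sum_congr rfl fun a _ => ?_
  rw [h1]
  push_cast
  norm_num
  ring

theorem sum_oddHarmonic_div_eq (k j : ℕ) :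
    ∑ i ∈ Finset.Icc 1 (j + 1), (-1 : ℝ) ^ (j + 1) * 3 * ArctanSums.oddHarmonic i
      / ((i : ℝ) * (2 * ((j + 1 : ℕ) : ℝ) + 1) * (2 * ((j + 1 : ℕ) : ℝ) + 2 * (k : ℝ) + 3) ^ 2)
    = -3 * (-1 : ℝ) ^ j * oddHarmonicSum j /
        ((2 * (j : ℝ) + 3) * (2 * (j : ℝ) + 2 * k + 5) ^ 2) := by
  rw [oddHarmonicSum, Finset.range_eq_Ico, ← Finset.Ico_add_one_right_eq_Icc,
    ← Finset.sum_Ico_add' _ 0 (j + 1) 1, Finset.mul_sum, Finset.sum_div]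
  refine Finset.sum_congr rfl fun a _ => ?_
  have h1 : (a : ℝ) + 1 ≠ 0 := by positivity
  have h2 : (2 * (j : ℝ) + 3) ≠ 0 := by positivity
  have h3 : (2 * (j : ℝ) + 2 * k + 5) ≠ 0 := by positivity
  push_cast
  rw [show (2 * ((j : ℝ) + 1) + 1) = 2 * j + 3 by ring,
    show (2 * ((j : ℝ) + 1) + 2 * k + 3) = 2 * j + 2 * k + 5 by ring]
  field_simp
  ring

/-! ### The blocks A and B as integrals -/

theorem polygamma_zero (x : ℝ) : ArctanSums.polygamma 0 x = logDeriv Gamma x := by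
  rw [ArctanSums.polygamma, iteratedDeriv_zero]

theorem polygamma_one (x : ℝ) : ArctanSums.polygamma 1 x = deriv (logDeriv Gamma) x := by
  rw [ArctanSums.polygamma, iteratedDeriv_one]

theorem continuous_one_div_one_add_sq : Continuous fun x : ℝ => 1 / (1 + x ^ 2) := by
  simpa only [one_div] using continuous_one_add_sq_inv

theorem integral_pow_mul_arctan (p : ℕ) :
    ∫ x in (0 : ℝ)..1, x ^ (1 + 2 * p) * arctan x =
      (π + ArctanSums.polygamma 0 ((2 * (p : ℝ) + 3) / 4)
        - ArctanSums.polygamma 0 ((2 * (p : ℝ) + 5) / 4)) / (8 * ((p : ℝ) + 1)) := by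
  have h := integral_pow_mul_eq hasDerivAt_arctan continuous_one_div_one_add_sq (1 + 2 * p)
  simp_rw [mul_one_div] at h
  rw [integral_pow_div_one_add_sq] at h
  rw [h, arctan_one, polygamma_zero, polygamma_zero]
  have hp : (p : ℝ) + 1 ≠ 0 := by positivity
  push_cast
  rw [show (1 + 2 * (p : ℝ) + 1 + 3) = 2 * p + 5 by ring,
    show (1 + 2 * (p : ℝ) + 1 + 1) = 2 * p + 3 by ring,
    show (1 + 2 * (p : ℝ) + 1) = 2 * (p + 1) by ring]
  field_simp
  ring

theorem integral_pow_mul_arctan_mul_log (p : ℕ) :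
    ∫ x in (0 : ℝ)..1, x ^ (1 + 2 * p) * (arctan x * log x) =
      1 / (64 * ((p : ℝ) + 1) ^ 2) * (-4 * π
        + 4 * ArctanSums.polygamma 0 ((2 * (p : ℝ) + 5) / 4)
        - 4 * ArctanSums.polygamma 0 ((2 * (p : ℝ) + 3) / 4)
        - 2 * ((p : ℝ) + 1) * ArctanSums.polygamma 1 ((2 * (p : ℝ) + 5) / 4)
        + 2 * ((p : ℝ) + 1) * ArctanSums.polygamma 1 ((2 * (p : ℝ) + 3) / 4)) := by
  have h := integral_pow_mul_log_mul_eq hasDerivAt_arctan continuous_one_div_one_add_sq (1 + 2 * p)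
  simp_rw [mul_one_div, mul_assoc] at h
  rw [integral_pow_div_one_add_sq, integral_pow_div_one_add_sq_mul_log] at h
  rw [h, arctan_one, polygamma_zero, polygamma_zero, polygamma_one, polygamma_one]
  have hp : (p : ℝ) + 1 ≠ 0 := by positivity
  push_cast
  rw [show (1 + 2 * (p : ℝ) + 1 + 3) = 2 * p + 5 by ring,
    show (1 + 2 * (p : ℝ) + 1 + 1) = 2 * p + 3 by ring,
    show (1 + 2 * (p : ℝ) + 1) = 2 * (p + 1) by ring]
  field_simp
  ring

theorem integral_odd_pow_div_mul_arctan (m : ℕ) :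
    ∫ x in (0 : ℝ)..1, x ^ (1 + 2 * m) / (1 + x ^ 2) * arctan x =
      ∑ i ∈ Finset.Icc 1 m, (-1 : ℝ) ^ (i + 1) *
          (∫ x in (0 : ℝ)..1, x ^ (1 + 2 * (m - i)) * arctan x)
        + (-1) ^ m * (ArctanSums.catalan / 2 - π * log 2 / 8) := by
  rw [integral_pow_add_two_mul_div (continuous_arctan.intervalIntegrable _ _)]
  simp_rw [pow_one]
  rw [integral_mul_arctan_div_one_add_sq]

theorem integral_odd_pow_div_mul_arctan_mul_log (m : ℕ) :
    ∫ x in (0 : ℝ)..1, x ^ (1 + 2 * m) / (1 + x ^ 2) * (arctan x * log x) =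
      ∑ i ∈ Finset.Icc 1 m, (-1 : ℝ) ^ (i + 1) *
          (∫ x in (0 : ℝ)..1, x ^ (1 + 2 * (m - i)) * (arctan x * log x))
        + (-1) ^ m * (π ^ 3 / 32 + π * log 2 ^ 2 / 16 - 2 * ArctanSums.W3) := by
  rw [integral_pow_add_two_mul_div (intervalIntegrable_mul_log continuous_arctan 0 1)]
  simp_rw [pow_one]
  rw [integral_mul_log_mul_arctan_div_one_add_sq]

theorem hasDerivAt_arctan_sq (x : ℝ) :
    HasDerivAt (fun x => arctan x ^ 2) (2 * arctan x * (1 / (1 + x ^ 2))) x := by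
  simpa using (hasDerivAt_arctan x).fun_pow 2

theorem continuous_deriv_arctan_sq :
    Continuous fun x : ℝ => 2 * arctan x * (1 / (1 + x ^ 2)) :=
  (continuous_arctan.const_mul 2).mul continuous_one_div_one_add_sq

theorem integral_even_pow_mul_arctan_sq (m : ℕ) :
    ∫ x in (0 : ℝ)..1, x ^ (0 + 2 * m) * arctan x ^ 2 =
      (π ^ 2 / 16 - 2 * ∫ x in (0 : ℝ)..1, x ^ (1 + 2 * m) / (1 + x ^ 2) * arctan x)
        / (2 * (m : ℝ) + 1) := by
  have h := integral_pow_mul_eq hasDerivAt_arctan_sq continuous_deriv_arctan_sq (0 + 2 * m)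
  have e1 : ∀ x : ℝ, x ^ (0 + 2 * m + 1) * (2 * arctan x * (1 / (1 + x ^ 2))) =
      2 * (x ^ (1 + 2 * m) / (1 + x ^ 2) * arctan x) := fun x => by ring
  simp_rw [e1] at h
  rw [intervalIntegral.integral_const_mul, arctan_one] at h
  rw [h]
  push_cast
  ring

theorem integral_even_pow_mul_arctan_sq_mul_log (m : ℕ) :
    ∫ x in (0 : ℝ)..1, x ^ (0 + 2 * m) * (arctan x ^ 2 * log x) =
      -(π ^ 2 / 16 - 2 * ∫ x in (0 : ℝ)..1, x ^ (1 + 2 * m) / (1 + x ^ 2) * arctan x)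
          / (2 * (m : ℝ) + 1) ^ 2
        - 2 * (∫ x in (0 : ℝ)..1, x ^ (1 + 2 * m) / (1 + x ^ 2) * (arctan x * log x))
          / (2 * (m : ℝ) + 1) := by
  have h := integral_pow_mul_log_mul_eq hasDerivAt_arctan_sq continuous_deriv_arctan_sq (0 + 2 * m)
  have e1 : ∀ x : ℝ, x ^ (0 + 2 * m + 1) * (2 * arctan x * (1 / (1 + x ^ 2))) =
      2 * (x ^ (1 + 2 * m) / (1 + x ^ 2) * arctan x) := fun x => by ring
  have e2 : ∀ x : ℝ, 2 * (x ^ (1 + 2 * m) / (1 + x ^ 2) * arctan x) * log x =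
      2 * (x ^ (1 + 2 * m) / (1 + x ^ 2) * (arctan x * log x)) := fun x => by ring
  simp_rw [e1, e2] at h
  rw [intervalIntegral.integral_const_mul, intervalIntegral.integral_const_mul, arctan_one] at h
  simp_rw [mul_assoc] at h
  rw [h]
  push_cast
  ring

theorem blockA_eq {k j : ℕ} (hj : j ∈ Finset.Icc 1 (k + 1)) :
    ArctanSums.blockA k j = π ^ 2 / 8 -
      4 * ∫ x in (0 : ℝ)..1, x ^ (1 + 2 * (k + 1 - j)) / (1 + x ^ 2) * arctan x := by
  rw [Finset.mem_Icc] at hj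
  obtain ⟨m, hm⟩ : ∃ m, k + 1 = m + j := ⟨k + 1 - j, by omega⟩
  have hk : (k : ℝ) = m + j - 1 := by
    have : ((k + 1 : ℕ) : ℝ) = (m + j : ℕ) := by rw [hm]
    push_cast at this; linarith
  rw [ArctanSums.blockA, hm, Nat.add_sub_cancel, integral_odd_pow_div_mul_arctan, mul_add,
    Finset.mul_sum]
  have hs : ∀ i ∈ Finset.Icc 1 m, (-1 : ℝ) ^ (i + 1) *
        ((π + ArctanSums.genHarmonic ((2 * (k : ℝ) - 2 * j - 2 * i + 1) / 4)
            - ArctanSums.genHarmonic ((2 * (k : ℝ) - 2 * j - 2 * i + 3) / 4))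
          / (2 * ((k : ℝ) - j - i + 2))) =
      4 * ((-1 : ℝ) ^ (i + 1) * ∫ x in (0 : ℝ)..1, x ^ (1 + 2 * (m - i)) * arctan x) := by
    intro i hi
    rw [Finset.mem_Icc] at hi
    obtain ⟨p, rfl⟩ : ∃ p, m = p + i := ⟨m - i, by omega⟩
    rw [Nat.add_sub_cancel, integral_pow_mul_arctan, ArctanSums.genHarmonic,
      ArctanSums.genHarmonic, hk]
    push_cast
    rw [show (2 * ((p : ℝ) + i + j - 1) - 2 * j - 2 * i + 1) / 4 + 1 = (2 * p + 3) / 4 by ring,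
      show (2 * ((p : ℝ) + i + j - 1) - 2 * j - 2 * i + 3) / 4 + 1 = (2 * p + 5) / 4 by ring,
      show ((p : ℝ) + i + j - 1 - j - i + 2) = p + 1 by ring]
    have hp : (p : ℝ) + 1 ≠ 0 := by positivity
    field_simp
    ring
  rw [Finset.sum_congr rfl hs]
  ring

theorem blockB_eq {k j : ℕ} (hj : j ∈ Finset.Icc 1 (k + 1)) :
    ArctanSums.blockB k j = -π ^ 2 / 16
      + ((k : ℝ) + 1 - j) / (2 * (k : ℝ) + 3 - 2 * j) * ArctanSums.blockA k j
      - 2 * (∫ x in (0 : ℝ)..1, x ^ (1 + 2 * (k + 1 - j)) / (1 + x ^ 2) * (arctan x * log x))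
      + 2 * ∫ x in (0 : ℝ)..1, x ^ (1 + 2 * (k + 1 - j)) / (1 + x ^ 2) * arctan x := by
  rw [Finset.mem_Icc] at hj
  obtain ⟨m, hm⟩ : ∃ m, k + 1 = m + j := ⟨k + 1 - j, by omega⟩
  have hk : (k : ℝ) = m + j - 1 := by
    have : ((k + 1 : ℕ) : ℝ) = (m + j : ℕ) := by rw [hm]
    push_cast at this; linarith
  rw [ArctanSums.blockB, hm, Nat.add_sub_cancel, integral_odd_pow_div_mul_arctan,
    integral_odd_pow_div_mul_arctan_mul_log]
  have hs : ∀ i ∈ Finset.Icc 1 m, (-1 : ℝ) ^ (i + 1) *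
        ((π + ArctanSums.genHarmonic ((2 * (k : ℝ) + 1 - 2 * j - 2 * i) / 4)
            - ArctanSums.genHarmonic ((2 * (k : ℝ) + 3 - 2 * j - 2 * i) / 4))
          / (8 * ((k : ℝ) + 2 - j - i))) =
      (-1 : ℝ) ^ (i + 1) * ∫ x in (0 : ℝ)..1, x ^ (1 + 2 * (m - i)) * arctan x := by
    intro i hi
    rw [Finset.mem_Icc] at hi
    obtain ⟨p, rfl⟩ : ∃ p, m = p + i := ⟨m - i, by omega⟩
    rw [Nat.add_sub_cancel, integral_pow_mul_arctan, ArctanSums.genHarmonic,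
      ArctanSums.genHarmonic, hk]
    push_cast
    rw [show (2 * ((p : ℝ) + i + j - 1) + 1 - 2 * j - 2 * i) / 4 + 1 = (2 * p + 3) / 4 by ring,
      show (2 * ((p : ℝ) + i + j - 1) + 3 - 2 * j - 2 * i) / 4 + 1 = (2 * p + 5) / 4 by ring,
      show ((p : ℝ) + i + j - 1 + 2 - j - i) = p + 1 by ring]
    ring
  have hs' : ∀ i ∈ Finset.Icc 1 m, (-1 : ℝ) ^ (i + 1) / (64 * ((k : ℝ) + 2 - j - i) ^ 2) *
            (-4 * π
              + 4 * ArctanSums.polygamma 0 ((2 * (k : ℝ) + 7 - 2 * j - 2 * i) / 4)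
              - 4 * ArctanSums.polygamma 0 ((2 * (k : ℝ) + 5 - 2 * j - 2 * i) / 4)
              - 2 * ((k : ℝ) + 2 - j - i)
                * ArctanSums.polygamma 1 ((2 * (k : ℝ) + 7 - 2 * j - 2 * i) / 4)
              + 2 * ((k : ℝ) + 2 - j - i)
                * ArctanSums.polygamma 1 ((2 * (k : ℝ) + 5 - 2 * j - 2 * i) / 4)) =
      (-1 : ℝ) ^ (i + 1) * ∫ x in (0 : ℝ)..1, x ^ (1 + 2 * (m - i)) * (arctan x * log x) := by
    intro i hi
    rw [Finset.mem_Icc] at hi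
    obtain ⟨p, rfl⟩ : ∃ p, m = p + i := ⟨m - i, by omega⟩
    rw [Nat.add_sub_cancel, integral_pow_mul_arctan_mul_log, hk]
    push_cast
    rw [show (2 * ((p : ℝ) + i + j - 1) + 7 - 2 * j - 2 * i) / 4 = (2 * p + 5) / 4 by ring,
      show (2 * ((p : ℝ) + i + j - 1) + 5 - 2 * j - 2 * i) / 4 = (2 * p + 3) / 4 by ring,
      show ((p : ℝ) + i + j - 1 + 2 - j - i) = p + 1 by ring]
    ring
  rw [Finset.sum_congr rfl hs, Finset.sum_congr rfl hs']
  ring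

theorem integral_even_pow_mul_arctan_sq_eq_blockA {k j : ℕ} (hj : j ∈ Finset.Icc 1 (k + 1)) :
    ∫ x in (0 : ℝ)..1, x ^ (0 + 2 * (k + 1 - j)) * arctan x ^ 2 =
      1 / (2 * (2 * (k : ℝ) + 3 - 2 * j)) * ArctanSums.blockA k j := by
  rw [integral_even_pow_mul_arctan_sq, blockA_eq hj]
  rw [Finset.mem_Icc] at hj
  rw [Nat.cast_sub hj.2]
  have h : (0 : ℝ) < 2 * k + 3 - 2 * j := by
    have : (j : ℝ) ≤ k + 1 := by exact_mod_cast hj.2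
    linarith
  push_cast
  rw [show 2 * ((k : ℝ) + 1 - j) + 1 = 2 * k + 3 - 2 * j by ring]
  field_simp
  ring

/-- With y = 2k+3-2j, the coefficient of A in B is (y-1)/(2y) = 1/2 - 1/(2y). The half cancels
-π²/16 and the last integral in B; the rest is the 1/y² term of the integration by parts. -/
theorem integral_even_pow_mul_arctan_sq_mul_log_eq_blockB {k j : ℕ}
    (hj : j ∈ Finset.Icc 1 (k + 1)) :
    ∫ x in (0 : ℝ)..1, x ^ (0 + 2 * (k + 1 - j)) * (arctan x ^ 2 * log x) =
      1 / (2 * (k : ℝ) + 3 - 2 * j) * ArctanSums.blockB k j := by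
  rw [integral_even_pow_mul_arctan_sq_mul_log, blockB_eq hj, blockA_eq hj]
  rw [Finset.mem_Icc] at hj
  rw [Nat.cast_sub hj.2]
  have h : (0 : ℝ) < 2 * k + 3 - 2 * j := by
    have : (j : ℝ) ≤ k + 1 := by exact_mod_cast hj.2
    linarith
  push_cast
  rw [show 2 * ((k : ℝ) + 1 - j) + 1 = 2 * k + 3 - 2 * j by ring,
    show (k : ℝ) + 1 - j = ((2 * k + 3 - 2 * j) - 1) / 2 by ring]
  generalize 2 * (k : ℝ) + 3 - 2 * j = y at h
  field_simp
  ring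

/-! ### Assembly of the closed form -/

theorem integral_arctan_sq_mul_logWeight (k : ℕ) :
    -3 * ∫ x in (0 : ℝ)..1, arctan x ^ 2 * (1 / (1 + x ^ 2)) * logWeight (2 * k + 2) x =
      ArctanSums.closedForm k := by
  have iθ : IntervalIntegrable (fun x : ℝ => arctan x ^ 2) volume 0 1 :=
    (continuous_arctan.pow 2).intervalIntegrable _ _
  have il : IntervalIntegrable (fun x : ℝ => arctan x ^ 2 * log x) volume 0 1 :=
    intervalIntegrable_mul_log (continuous_arctan.pow 2) 0 1
  have e : ∀ x : ℝ, arctan x ^ 2 * (1 / (1 + x ^ 2)) * logWeight (2 * k + 2) x =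
      1 / (2 * (k : ℝ) + 2) * (x ^ (0 + 2 * (k + 1)) / (1 + x ^ 2) * (arctan x ^ 2 * log x))
      + 1 / (2 * (k : ℝ) + 2) ^ 2 * (1 / (1 + x ^ 2) * arctan x ^ 2)
      - 1 / (2 * (k : ℝ) + 2) ^ 2 * (x ^ (0 + 2 * (k + 1)) / (1 + x ^ 2) * arctan x ^ 2) :=
    fun x => by rw [logWeight]; push_cast; ring
  simp_rw [e]
  have i1 := (il.continuousOn_mul
    (continuous_pow_div_one_add_sq (0 + 2 * (k + 1))).continuousOn).const_mul (1 / (2 * (k : ℝ) + 2))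
  have i2 := (iθ.continuousOn_mul continuous_one_div_one_add_sq.continuousOn).const_mul
    (1 / (2 * (k : ℝ) + 2) ^ 2)
  have i3 := (iθ.continuousOn_mul
    (continuous_pow_div_one_add_sq (0 + 2 * (k + 1))).continuousOn).const_mul
    (1 / (2 * (k : ℝ) + 2) ^ 2)
  rw [intervalIntegral.integral_sub (i1.add i2) i3, intervalIntegral.integral_add i1 i2]
  simp only [intervalIntegral.integral_const_mul]
  rw [integral_pow_add_two_mul_div iθ, integral_pow_add_two_mul_div il]
  simp only [pow_zero]
  rw [integral_arctan_sq_mul_log_div_one_add_sq, integral_arctan_sq_div_one_add_sq]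
  have hA : ∑ j ∈ Finset.Icc 1 (k + 1), (-1 : ℝ) ^ (j + 1) *
      (∫ x in (0 : ℝ)..1, x ^ (0 + 2 * (k + 1 - j)) * arctan x ^ 2) =
      ∑ j ∈ Finset.Icc 1 (k + 1),
        (-1 : ℝ) ^ (j + 1) / (2 * (2 * (k : ℝ) + 3 - 2 * j)) * ArctanSums.blockA k j :=
    Finset.sum_congr rfl fun j hj => by
      rw [integral_even_pow_mul_arctan_sq_eq_blockA hj]; ring
  have hB : ∑ j ∈ Finset.Icc 1 (k + 1), (-1 : ℝ) ^ (j + 1) *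
      (∫ x in (0 : ℝ)..1, x ^ (0 + 2 * (k + 1 - j)) * (arctan x ^ 2 * log x)) =
      ∑ j ∈ Finset.Icc 1 (k + 1),
        (-1 : ℝ) ^ (j + 1) / (2 * (k : ℝ) + 3 - 2 * j) * ArctanSums.blockB k j :=
    Finset.sum_congr rfl fun j hj => by
      rw [integral_even_pow_mul_arctan_sq_mul_log_eq_blockB hj]; ring
  -- The closed form splits terms that combine here: the two A-sums have total coefficient
  -- 3/(4(k+1)²), because -(2k+1) + 2(k+1) = 1, and the π³ terms merge in the same way.
  rw [hA, hB, ArctanSums.closedForm]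
  have hk : (k : ℝ) + 1 ≠ 0 := by positivity
  rw [show 2 * (k : ℝ) + 2 = 2 * (k + 1) by ring]
  field_simp
  ring

end

/-- Both series are summed from their first term; in the first one the outer index `j ≥ 1` of the
double series is written as `j + 1` with `j : ℕ`. -/
theorem theorem3p5 (k : ℕ) :
    HasSum
      (fun j : ℕ => ∑ i ∈ Finset.Icc 1 (j + 1),
        (-1 : ℝ) ^ (j + 1) * 3 * ArctanSums.oddHarmonic i
          / ((i : ℝ) * (2 * ((j + 1 : ℕ) : ℝ) + 1) * (2 * ((j + 1 : ℕ) : ℝ) + 2 * (k : ℝ) + 3) ^ 2))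
      (ArctanSums.closedForm k) ∧
    HasSum
      (fun n : ℕ => 3 / 4 *
        ((-1 : ℝ) ^ (n + 1) * ArctanSums.milgram 2 n
          / (((n : ℝ) + 3 / 2) * (2 * (n : ℝ) + 2 * (k : ℝ) + 5) ^ 2)))
      (ArctanSums.closedForm k) := by
  have h := hasSum_oddHarmonicSum k
  rw [integral_arctan_sq_mul_logWeight] at h
  refine ⟨?_, ?_⟩
  · simpa only [sum_oddHarmonic_div_eq] using h
  · convert! h using 2 with n
    -- One factor 2 from t_n(2) = 2 S_n and one from n + 3/2 = (2n+3)/2 turn 3/4 into 3.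
    rw [milgram_two_eq]
    have h2 : (2 * (n : ℝ) + 3) ≠ 0 := by positivity
    have h3 : (2 * (n : ℝ) + 2 * k + 5) ≠ 0 := by positivity
    rw [show (n : ℝ) + 3 / 2 = (2 * n + 3) / 2 by ring]
    field_simp
    ring
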